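/- **Setting.** Let $\mathcal X,\mathcal G,\mathcal H$ be finite sets of tasks, representations and predictors, with $\mathcal X,\mathcal H\ne\emptyset$ and $|\mathcal G|\ge 2$, and put $K=|\mathcal X||\mathcal G||\mathcal H|$. Let $\mathcal M$ be the set of tables $\mu=(\mu(x,g,h))\in[0,1]^{\mathcal X\times\mathcal G\times\mathcal H}$ for which there are $g^\star\in\mathcal G$ and $(h^\star_x)_{x\in\mathcal X}$ with $\mu(x,g^\star,h^\star_x)>\mu(x,g,h)$ for every $x$ and every $(g,h)\neq(g^\star,h_x^\star)$. Fix $\mu\in\mathcal M$. In each round the learner chooses, from the past, a triple $(x,g,h)$ and then observes a reward which, given the past, is Bernoulli of mean $\mu(x,g,h)$. Let $N_t(x,g,h)$ be the number of plays of $(x,g,h)$ in the first $t$ rounds, and $\hat\mu_t(x,g,h)$ its empirical mean ($0$ if $N_t(x,g,h)=0$). Let $\mathrm{kl}(p,q)$ be the relative entropy between Bernoulli laws of means $p$ and $q$. For weights $w\ge 0$ on $\mathcal X\times\mathcal G\times\mathcal H$ and $S\subseteq\mathcal G\times\mathcal H$, let $m^{w,\nu}_x(S)=\sum_{a\in S}w(x,a)\nu(x,a)/\sum_{a\in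 S}w(x,a)$ (read as $0$ if the denominator is $0$). For $b=(\bar g,\bar h)$ let $$\mathcal U^{w,\nu}_{x,b}=\{b\}\cup\Big\{a:\ \nu(x,a)\ge m^{w,\nu}_x\big(\{b\}\cup\{a':\nu(x,a')\ge\nu(x,a)\}\big)\Big\},$$ and define $$E_g(w,\nu)=\min_{\bar g\ne g}\sum_{x}\min_{\bar h}\sum_{a\in\mathcal U^{w,\nu}_{x,(\bar g,\bar h)}}w(x,a)\,\mathrm{kl}\big(\nu(x,a),m^{w,\nu}_x(\mathcal U^{w,\nu}_{x,(\bar g,\bar h)})\big).$$ Let $\Sigma$ be the simplex of probability vectors on $\mathcal X\times\mathcal G\times\mathcal H$. For $\nu\in\mathcal M$ with optimal representation $g^\star(\nu)$ and $q\in\Sigma$, put $\rho(q,\nu)=E_{g^\star(\nu)}(q,\nu)$ and $\rho_\sigma(q,\nu)=\rho(q,\nu)-\frac1{2\sigma}\|q\|_2^2$. Let $q^\star_\sigma(\nu)$ denote the maximizer of $\rho_\sigma(\cdot,\nu)$ over $\Sigma$, and let $$K^\star_{G,\sigma}(\mu,\delta)=\frac{\mathrm{kl}(\delta,1-\delta)}{\max_{q\in\Sigma}\rho_\sigma(q,\mu)}\qquad(+\infty\text{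 if the maximum is not positive}).$$ **Tracking rule with parameter $\sigma>0$.** After $t\ge0$ rounds, if some triple satisfies $N_t(x,g,h)<\sqrt t-K/2$, play a triple with the least $N_t$ among these. Otherwise play a triple that maximizes $t\,q_t(x,g,h)-N_t(x,g,h)$, where $q_t\in\Sigma$ equals $q_\sigma^\star(\hat\mu_t)$ if $\hat\mu_t\in\mathcal M$ and is arbitrary otherwise. Ties are broken arbitrarily. **Stopping rule.** Given thresholds $\beta_t(\delta_G)$, put $\Psi_t(g)=E_g(N_t,\hat\mu_t)$ and $\tau_G=\inf\{t\ge1:\max_{g}\Psi_t(g)>\beta_t(\delta_G)\}$. **Theorem.** For $\delta_G\in(0,1)$ let $(\beta_t(\delta_G))_{t\ge 1}$ be a deterministic sequence that is non-decreasing in $t$, and suppose there are constants $C,D>0$ with $\beta_t(\delta_G)\le\ln(Dt/\delta_G)$ for all $t\ge C$ and all $\delta_G\in(0,1)$. Then, for every $\sigma>0$, under the tracking rule with parameter $\sigma$, $$\limsup_{\delta_G\to0}\frac{\mathbb E_\mu[\tau_G]}{K^\star_{G,\sigma}(\mu,\delta_G)}\le1,\qquad\text{and moreover}\qquad \limsup_{\delta_G\to0}\frac{\mathbb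 E_\mu[\tau_G]}{\mathrm{kl}(\delta_G,1-\delta_G)/\rho(q^\star_\sigma(\mu),\mu)}\le1 .$$ -/

import Mathlib

open Filter Topology MeasureTheory ProbabilityTheory
open scoped ENNReal

noncomputable section

namespace OSRL

/-- Bernoulli relative entropy `kl(p, q)` between means `p` and `q` (with `0 log 0 = 0`). -/
def kl (p q : ℝ) : ℝ :=
  p * Real.log (p / q) + (1 - p) * Real.log ((1 - p) / (1 - q))

section Model

variable {X G H : Type*}

/-- In every task `x`, the pair `(g, h x)` is the unique best arm of `μ`. -/
def IsOptimal (μ : X × G × H → ℝ) (g : G) (h : X → H) : Prop :=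
  ∀ (x : X) (a : G × H), a ≠ (g, h x) → μ (x, a) < μ (x, (g, h x))

/-- The set of models: tables of Bernoulli means for which every task has a unique best arm, and
the representation of the best arm is the same for all tasks. -/
def models (X G H : Type*) : Set (X × G × H → ℝ) :=
  {μ | (∀ a, μ a ∈ Set.Icc (0 : ℝ) 1) ∧ ∃ (g : G) (h : X → H), IsOptimal μ g h}

/-- The optimal representation `g⋆` of a model. -/
def optRep [Nonempty G] (μ : X × G × H → ℝ) : G :=
  Classical.epsilon fun g => ∃ h : X → H, IsOptimal μ g h

/-- Average of the means of the arms in `S`, in task `x`, with weights `w`. -/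
def wAvg (w μ : X × G × H → ℝ) (x : X) (S : Finset (G × H)) : ℝ :=
  (∑ a ∈ S, w (x, a) * μ (x, a)) / ∑ a ∈ S, w (x, a)

variable [Fintype X] [Fintype G] [Fintype H]

open scoped Classical in
/-- The set `U` of the arms of task `x` whose means must be moved to make `b = (ḡ, h̄)` the best
arm of the task: `b` itself, and every arm whose mean is at least the weighted average over `b`
and the arms that are at least as good as it. -/
def confusingArms (w μ : X × G × H → ℝ) (x : X) (b : G × H) : Finset (G × H) :=
  {a | a = b ∨
    wAvg w μ x (insert b (Finset.univ.filter fun a' => μ (x, a) ≤ μ (x, a'))) ≤ μ (x, a)}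

/-- `m(x, ḡ, h̄)`, the common value to which the means of the arms in `U` are moved. -/
def confusingMean (w μ : X × G × H → ℝ) (x : X) (b : G × H) : ℝ :=
  wAvg w μ x (confusingArms w μ x b)

/-- `∑_{(g,h) ∈ U} w(x,g,h) kl(μ(x,g,h), m(x,ḡ,h̄))`, for `b = (ḡ, h̄)`. -/
def confusingCost (w μ : X × G × H → ℝ) (x : X) (b : G × H) : ℝ :=
  ∑ a ∈ confusingArms w μ x b, w (x, a) * kl (μ (x, a)) (confusingMean w μ x b)

/-- `min_{ḡ ≠ g} ∑_x min_{h̄} ∑_{(g',h') ∈ U} w(x,g',h') kl(μ(x,g',h'), m(x,ḡ,h̄))`. -/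
def evidence (g : G) (w μ : X × G × H → ℝ) : ℝ :=
  ⨅ g' : {g' : G // g' ≠ g}, ∑ x : X, ⨅ h : H, confusingCost w μ x (g'.1, h)

/-- `ρ(q, μ)`. -/
def rho [Nonempty G] (q μ : X × G × H → ℝ) : ℝ := evidence (optRep μ) q μ

/-- `ρ_σ(q, μ) = ρ(q, μ) - ‖q‖₂² / (2σ)`. -/
def rhoReg [Nonempty G] (σ : ℝ) (q μ : X × G × H → ℝ) : ℝ :=
  rho q μ - (∑ a, q a ^ 2) / (2 * σ)

/-- `q` is an optimal `σ`-regularized allocation for `μ`: it maximizes `ρ_σ(·, μ)` over the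
simplex. -/
def IsOptAlloc [Nonempty G] (σ : ℝ) (μ q : X × G × H → ℝ) : Prop :=
  q ∈ stdSimplex ℝ (X × G × H) ∧
    ∀ q' ∈ stdSimplex ℝ (X × G × H), rhoReg σ q' μ ≤ rhoReg σ q μ

/-- The constant `K⋆_{G,σ}(μ, δ) = kl(δ, 1-δ) / max_q ρ_σ(q, μ)`, which is `+∞` if the maximum is
not positive. -/
def KReg [Nonempty G] (σ : ℝ) (μ : X × G × H → ℝ) (δ : ℝ) : ℝ≥0∞ :=
  ENNReal.ofReal (kl δ (1 - δ)) /
    ENNReal.ofReal (⨆ q : stdSimplex ℝ (X × G × H), rhoReg σ (q : X × G × H → ℝ) μ)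

end Model

section Algorithm

variable {X G H Ω : Type*}

open scoped Classical in
/-- Number of times that arm `a` was played in the first `t` rounds; `A s` is the triple
(task, representation, predictor) played in round `s + 1`. -/
def count (A : ℕ → Ω → X × G × H) (t : ℕ) (ω : Ω) (a : X × G × H) : ℝ :=
  (((Finset.range t).filter fun s => A s ω = a).card : ℝ)

open scoped Classical in
/-- Empirical mean of arm `a` after `t` rounds (`0` if the arm was not played yet); `R s` is the
reward of round `s + 1`. -/
def empMean (A : ℕ → Ω → X × G × H) (R : ℕ → Ω → ℝ) (t : ℕ) (ω : Ω) (a : X × G × H) : ℝ :=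
  (∑ s ∈ (Finset.range t).filter fun s => A s ω = a, R s ω) / count A t ω a

/-- Interaction with the bandit `μ`: the arm of each round is chosen from the past, and, given the
past, the reward is Bernoulli with the mean of this arm. -/
structure IsBandit {mΩ : MeasurableSpace Ω} (P : Measure Ω) (ℱ : Filtration ℕ mΩ)
    (μ : X × G × H → ℝ) (A : ℕ → Ω → X × G × H) (R : ℕ → Ω → ℝ) : Prop where
  arm_predictable : ∀ t a, MeasurableSet[ℱ t] {ω | A t ω = a}
  reward_adapted : ∀ t, Measurable[ℱ (t + 1)] (R t)
  reward_binary : ∀ t ω, R t ω = 0 ∨ R t ω = 1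
  reward_mean : ∀ t, P[R t | ℱ t] =ᵐ[P] fun ω => μ (A t ω)

variable [Fintype X] [Fintype G] [Fintype H]

/-- The tracking rule of the first phase with parameter `σ`. If some arm was played fewer than
`√t - XGH/2` times in the first `t` rounds, a least played such arm is played next. Otherwise an
arm that maximizes `t q(a) - N_t(a)` is played, where `q` is the optimal `σ`-regularized
allocation for the empirical model (any allocation if the empirical means are not a model). Ties
are broken arbitrarily. -/
def IsTracking [Nonempty G] (σ : ℝ) (A : ℕ → Ω → X × G × H) (R : ℕ → Ω → ℝ) : Prop :=
  ∀ (t : ℕ) (ω : Ω),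
    let U : Set (X × G × H) :=
      {a | count A t ω a < Real.sqrt t - (Fintype.card (X × G × H) : ℝ) / 2}
    (U.Nonempty → A t ω ∈ U ∧ ∀ a ∈ U, count A t ω (A t ω) ≤ count A t ω a) ∧
    (¬ U.Nonempty → ∃ q ∈ stdSimplex ℝ (X × G × H),
      (empMean A R t ω ∈ models X G H → IsOptAlloc σ (empMean A R t ω) q) ∧
      ∀ a, t * q a - count A t ω a ≤ t * q (A t ω) - count A t ω (A t ω))

/-- The statistic `Ψ_t(g)` of the stopping rule. -/
def Psi (A : ℕ → Ω → X × G × H) (R : ℕ → Ω → ℝ) (t : ℕ) (ω : Ω) (g : G) : ℝ :=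
  evidence g (count A t ω) (empMean A R t ω)

/-- The length of the first phase, `τ_G = inf {t ≥ 1 : max_g Ψ_t(g) > β_t}`. -/
def tauG (A : ℕ → Ω → X × G × H) (R : ℕ → Ω → ℝ) (β : ℕ → ℝ) (ω : Ω) : ℕ∞ :=
  ⨅ (t : ℕ) (_ : 1 ≤ t ∧ β t < ⨆ g : G, Psi A R t ω g), (t : ℕ∞)

end Algorithm

end OSRL

end

set_option linter.unusedSectionVars false

namespace OSRL

/-! The evidence against `g` is a minimal information cost. For fixed weights `w` and means `ν`, the
cost of `b` in a task is the least value of `∑ w kl(ν, l)` over tables `l` with `b` as a best arm,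
and pooling the arms of a threshold set attains it (`poolCost_le_of_isAlternative`,
`exists_isAlternative`). As a minimum of functions linear in `w`, it is superadditive and
homogeneous, hence concave. It is also jointly continuous on nonnegative weights and means in
`[0,1]`, boundary included (`continuousOn_confusingCost`).

The quadratic penalty makes `ρ_σ` strongly concave, so its maximizer is unique and depends
continuously on the model (`exists_forall_isOptAlloc_near`). Forced exploration gives every arm at
least of order `√t` plays. An exponential supermartingale then bounds the probability of an
inaccurate empirical mean at time `t` by a constant times `t⁻³`, and all means are accurate after a
random time `B` of finite expectation (`exists_settling_time`). From then on the tracked allocations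
are close to `q⋆`, so `N_t / t` becomes close to `q⋆`, and by continuity `Ψ_t(g⋆) > (ρ(q⋆, μ) - ε)
t` once `t` exceeds a multiple of the settling time (`exists_forall_lt_Psi`).

This line crosses the logarithmic threshold at about `log(1/δ) / (ρ - 2ε)`, up to a constant and a
multiple of `B`, neither depending on `δ`. Integrating and using `kl(δ, 1-δ) ~ log(1/δ)` gives the
second bound. The first follows because `max ρ_σ ≤ ρ(q⋆, μ)`. -/

/-! ### Bernoulli relative entropy -/

/-- This is `log x ≤ x - 1` at `x = l / m`. The hypothesis `h0` is absolute continuity: without it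
the conventions `p / 0 = 0` and `log 0 = 0` would turn an infinite divergence into `0`. -/
lemma mul_one_sub_div_le_mul_log {p m l : ℝ} (hp : 0 ≤ p) (hm : 0 < m) (hl : 0 ≤ l)
    (h0 : l = 0 → p = 0) :
    p * (1 - l / m) ≤ p * Real.log (p / l) - p * Real.log (p / m) := by
  rcases hp.eq_or_lt with rfl | hp
  · simp
  have hl' : 0 < l := hl.lt_of_ne fun h => hp.ne' (h0 h.symm)
  have h := Real.log_le_sub_one_of_pos (div_pos hl' hm)
  rw [Real.log_div hl'.ne' hm.ne'] at h
  rw [Real.log_div hp.ne' hl'.ne', Real.log_div hp.ne' hm.ne', ← mul_sub]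
  exact mul_le_mul_of_nonneg_left (by linarith) hp.le

lemma sub_le_mul_log_div {p l : ℝ} (hp : 0 ≤ p) (hl : 0 ≤ l) (h0 : l = 0 → p = 0) :
    p - l ≤ p * Real.log (p / l) := by
  rcases hp.eq_or_lt with rfl | hp
  · simpa using hl
  have h := mul_one_sub_div_le_mul_log hp.le hp hl h0
  rw [div_self hp.ne', Real.log_one, mul_sub, mul_div_cancel₀ _ hp.ne'] at h
  linarith

lemma sub_lt_mul_log_div {p l : ℝ} (hp : 0 ≤ p) (hl : 0 ≤ l) (h0 : l = 0 → p = 0)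
    (hpl : p ≠ l) : p - l < p * Real.log (p / l) := by
  rcases hp.eq_or_lt with rfl | hp
  · simpa using hl.lt_of_ne hpl
  have hl' : 0 < l := hl.lt_of_ne fun h => hp.ne' (h0 h.symm)
  have h := Real.log_lt_sub_one_of_pos (div_pos hl' hp) (by
    rw [Ne, div_eq_one_iff_eq hp.ne']; exact hpl.symm)
  rw [← inv_div p l, Real.log_inv] at h
  have h2 := mul_lt_mul_of_pos_left h hp
  have h3 : p * ((p / l)⁻¹ - 1) = l - p := by field_simp
  linarith

@[simp] lemma kl_self (p : ℝ) : kl p p = 0 := by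
  simp [kl]

lemma kl_nonneg {p l : ℝ} (hp : p ∈ Set.Icc (0 : ℝ) 1) (hl : l ∈ Set.Icc (0 : ℝ) 1)
    (h0 : l = 0 → p = 0) (h1 : l = 1 → p = 1) : 0 ≤ kl p l := by
  have a := sub_le_mul_log_div hp.1 hl.1 h0
  have b := sub_le_mul_log_div (p := 1 - p) (l := 1 - l) (by linarith [hp.2]) (by linarith [hl.2])
    (fun h => by linarith [h1 (by linarith)])
  unfold kl; linarith

lemma kl_pos {p l : ℝ} (hp : p ∈ Set.Icc (0 : ℝ) 1) (hl : l ∈ Set.Icc (0 : ℝ) 1)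
    (h0 : l = 0 → p = 0) (h1 : l = 1 → p = 1) (hpl : p ≠ l) : 0 < kl p l := by
  have a := sub_lt_mul_log_div hp.1 hl.1 h0 hpl
  have b := sub_le_mul_log_div (p := 1 - p) (l := 1 - l) (by linarith [hp.2]) (by linarith [hl.2])
    (fun h => by linarith [h1 (by linarith)])
  unfold kl; linarith

/-- First-order lower bound for the convex function `kl p`. -/
lemma kl_tangent {p m l : ℝ} (hp : p ∈ Set.Icc (0 : ℝ) 1) (hm : m ∈ Set.Ioo (0 : ℝ) 1)
    (hl : l ∈ Set.Icc (0 : ℝ) 1) (h0 : l = 0 → p = 0) (h1 : l = 1 → p = 1) :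
    (l - m) * (m - p) / (m * (1 - m)) ≤ kl p l - kl p m := by
  have a := mul_one_sub_div_le_mul_log hp.1 hm.1 hl.1 h0
  have b := mul_one_sub_div_le_mul_log (p := 1 - p) (m := 1 - m) (l := 1 - l)
    (by linarith [hp.2]) (by linarith [hm.2]) (by linarith [hl.2])
    (fun h => by linarith [h1 (by linarith)])
  have hm0 := hm.1.ne'
  have hm1 : 1 - m ≠ 0 := by linarith [hm.2]
  have e : (l - m) * (m - p) / (m * (1 - m)) =
      p * (1 - l / m) + (1 - p) * (1 - (1 - l) / (1 - m)) := by
    field_simp; ring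
  unfold kl; linarith

/-! ### Pooling as an information projection -/

section Pool

variable {ι : Type*}

/-- Average of `ν` over `S` with weights `w`. -/
noncomputable def poolMean (w ν : ι → ℝ) (S : Finset ι) : ℝ :=
  (∑ a ∈ S, w a * ν a) / ∑ a ∈ S, w a

/-- Cost of moving all the means in `S` to their average. -/
noncomputable def poolCost (w ν : ι → ℝ) (S : Finset ι) : ℝ :=
  ∑ a ∈ S, w a * kl (ν a) (poolMean w ν S)

/-- `S` consists of `b` and of the elements whose means are above the average over `S`. -/
def IsThreshold (w ν : ι → ℝ) (b : ι) (S : Finset ι) : Prop :=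
  b ∈ S ∧ (∀ a ∈ S, a ≠ b → ∑ i ∈ S, w i * ν i ≤ ν a * ∑ i ∈ S, w i) ∧
    ∀ a ∉ S, ν a * ∑ i ∈ S, w i ≤ ∑ i ∈ S, w i * ν i

/-- `l` is a table of means for which `b` is a best element, and `ν` is absolutely continuous
with respect to `l` where `w` does not vanish. -/
structure IsAlternative (w ν : ι → ℝ) (b : ι) (l : ι → ℝ) : Prop where
  mem_Icc : ∀ a, l a ∈ Set.Icc (0 : ℝ) 1
  le_best : ∀ a, l a ≤ l b
  eq_zero : ∀ a, w a ≠ 0 → l a = 0 → ν a = 0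
  eq_one : ∀ a, w a ≠ 0 → l a = 1 → ν a = 1

variable {w ν : ι → ℝ} {b : ι} {S : Finset ι} {l : ι → ℝ}

lemma poolMean_mem_Icc (hw : ∀ a, 0 ≤ w a) (hν : ∀ a, ν a ∈ Set.Icc (0 : ℝ) 1) :
    poolMean w ν S ∈ Set.Icc (0 : ℝ) 1 :=
  ⟨div_nonneg (Finset.sum_nonneg fun a _ => mul_nonneg (hw a) (hν a).1)
    (Finset.sum_nonneg fun a _ => hw a),
  div_le_one_of_le₀ (Finset.sum_le_sum fun a _ => mul_le_of_le_one_right (hw a) (hν a).2)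
    (Finset.sum_nonneg fun a _ => hw a)⟩

lemma sum_pos_of_ne_zero (hw : ∀ a, 0 ≤ w a) {a : ι} (ha : a ∈ S) (hwa : w a ≠ 0) :
    0 < ∑ i ∈ S, w i :=
  ((hw a).lt_of_ne hwa.symm).trans_le (Finset.single_le_sum (fun i _ => hw i) ha)

lemma sum_mul_eq_poolMean_mul (hW : ∑ a ∈ S, w a ≠ 0) :
    ∑ a ∈ S, w a * ν a = poolMean w ν S * ∑ a ∈ S, w a :=
  (div_mul_cancel₀ _ hW).symm

/-- An average of values in `[0,1]` is extreme only if every value of nonzero weight is. Hence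
pooling keeps absolute continuity. -/
lemma eq_zero_of_poolMean_eq_zero (hw : ∀ a, 0 ≤ w a) (hν : ∀ a, ν a ∈ Set.Icc (0 : ℝ) 1)
    {a : ι} (ha : a ∈ S) (hwa : w a ≠ 0) (h : poolMean w ν S = 0) : ν a = 0 := by
  have hW := sum_pos_of_ne_zero hw ha hwa
  have := sum_mul_eq_poolMean_mul (ν := ν) hW.ne'
  rw [h, zero_mul, Finset.sum_eq_zero_iff_of_nonneg
    fun a _ => mul_nonneg (hw a) (hν a).1] at this
  exact (mul_eq_zero.1 (this a ha)).resolve_left hwa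

lemma eq_one_of_poolMean_eq_one (hw : ∀ a, 0 ≤ w a) (hν : ∀ a, ν a ∈ Set.Icc (0 : ℝ) 1)
    {a : ι} (ha : a ∈ S) (hwa : w a ≠ 0) (h : poolMean w ν S = 1) : ν a = 1 := by
  have hW := sum_pos_of_ne_zero hw ha hwa
  have h1 := sum_mul_eq_poolMean_mul (ν := ν) hW.ne'
  have h2 : ∑ a ∈ S, w a * (1 - ν a) = 0 := by
    simp only [mul_sub, mul_one, Finset.sum_sub_distrib]
    rw [h1, h]; ring
  rw [Finset.sum_eq_zero_iff_of_nonneg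
    fun a _ => mul_nonneg (hw a) (by linarith [(hν a).2])] at h2
  linarith [(mul_eq_zero.1 (h2 a ha)).resolve_left hwa]

/-- A form of the pooling cost that is continuous in all its arguments. -/
lemma poolCost_eq (hw : ∀ a, 0 ≤ w a) (hν : ∀ a, ν a ∈ Set.Icc (0 : ℝ) 1) :
    poolCost w ν S = Real.negMulLog (∑ a ∈ S, w a * ν a)
      + Real.negMulLog (∑ a ∈ S, w a - ∑ a ∈ S, w a * ν a)
      - Real.negMulLog (∑ a ∈ S, w a) - ∑ a ∈ S, w a * Real.binEntropy (ν a) := by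
  by_cases hW : ∑ a ∈ S, w a = 0
  · have h0 : ∀ a ∈ S, w a = 0 := (Finset.sum_eq_zero_iff_of_nonneg fun a _ => hw a).1 hW
    have e (f : ι → ℝ) : ∑ a ∈ S, w a * f a = 0 :=
      Finset.sum_eq_zero fun a ha => by rw [h0 a ha, zero_mul]
    simp [poolCost, e, hW]
  have key : ∀ a ∈ S, w a * kl (ν a) (poolMean w ν S) =
      -(w a * ν a) * Real.log (poolMean w ν S)
      - (w a - w a * ν a) * Real.log (1 - poolMean w ν S) - w a * Real.binEntropy (ν a) := by
    intro a ha
    by_cases hwa : w a = 0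
    · simp [hwa]
    have h0 := eq_zero_of_poolMean_eq_zero hw hν ha hwa
    have h1 := eq_one_of_poolMean_eq_one hw hν ha hwa
    have e {p m : ℝ} (h : m = 0 → p = 0) :
        p * Real.log (p / m) = p * Real.log p - p * Real.log m := by
      by_cases hp : p = 0
      · simp [hp]
      · rw [Real.log_div hp fun hm => hp (h hm)]; ring
    rw [kl, e h0, e fun h => by linarith [h1 (by linarith)], Real.binEntropy, Real.log_inv,
      Real.log_inv]
    ring
  rw [poolCost, Finset.sum_congr rfl key]
  simp only [Finset.sum_sub_distrib, ← Finset.sum_mul, Finset.sum_neg_distrib]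
  have hV := sum_mul_eq_poolMean_mul (ν := ν) hW
  set m := poolMean w ν S
  set W := ∑ a ∈ S, w a
  rw [hV]
  have hV' : W - m * W = (1 - m) * W := by ring
  rw [hV']
  rw [Real.negMulLog_mul, Real.negMulLog_mul]
  simp only [Real.negMulLog]
  ring

/-- Convexity and first-order optimality: sum the tangent bounds at the pooled mean `m` over `S`. An
arm of `S` other than `b` has `ν a ≥ m`, so replacing `l a` by the larger `l b` only lowers the
linear term, which then sums to zero by the definition of `m`. Arms outside `S` contribute
nonnegative costs. If `m` is `0` or `1` there is no tangent, but the pooling cost vanishes. -/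
lemma poolCost_le_of_isAlternative [Fintype ι] (hw : ∀ a, 0 ≤ w a)
    (hν : ∀ a, ν a ∈ Set.Icc (0 : ℝ) 1) (hS : IsThreshold w ν b S) (hl : IsAlternative w ν b l) :
    poolCost w ν S ≤ ∑ a, w a * kl (ν a) (l a) := by
  have hnn : ∀ a, 0 ≤ w a * kl (ν a) (l a) := by
    intro a
    by_cases hwa : w a = 0
    · simp [hwa]
    · exact mul_nonneg (hw a) (kl_nonneg (hν a) (hl.mem_Icc a) (hl.eq_zero a hwa)
        (hl.eq_one a hwa))
  have hm := poolMean_mem_Icc (S := S) hw hν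
  have trivial_case (h : ∀ a ∈ S, w a ≠ 0 → ν a = poolMean w ν S) :
      poolCost w ν S ≤ ∑ a, w a * kl (ν a) (l a) := by
    have : poolCost w ν S = 0 := Finset.sum_eq_zero fun a ha => by
      by_cases hwa : w a = 0
      · simp [hwa]
      · rw [← h a ha hwa]; simp
    rw [this]
    exact Finset.sum_nonneg fun a _ => hnn a
  rcases hm.1.eq_or_lt with h0 | h0
  · exact trivial_case fun a ha hwa => by
      rw [← h0]; exact eq_zero_of_poolMean_eq_zero hw hν ha hwa h0.symm
  rcases hm.2.eq_or_lt with h1 | h1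
  · exact trivial_case fun a ha hwa => by
      rw [h1]; exact eq_one_of_poolMean_eq_one hw hν ha hwa h1
  have hW : ∑ a ∈ S, w a ≠ 0 := fun h => by
    rw [poolMean, h, div_zero] at h0; exact lt_irrefl _ h0
  have hWpos : 0 < ∑ a ∈ S, w a :=
    (Finset.sum_nonneg fun a _ => hw a).lt_of_ne hW.symm
  have hV := sum_mul_eq_poolMean_mul (ν := ν) hW
  refine le_trans ?_ (Finset.sum_le_univ_sum_of_nonneg (s := S) hnn)
  set m := poolMean w ν S with hmdef
  have hmm : 0 < m * (1 - m) := mul_pos h0 (by linarith)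
  have h2 : ∀ a ∈ S, w a * kl (ν a) m + (l b - m) / (m * (1 - m)) * (w a * m - w a * ν a) ≤
      w a * kl (ν a) (l a) := by
    intro a ha
    by_cases hwa : w a = 0
    · simp [hwa]
    have ht := kl_tangent (hν a) ⟨h0, h1⟩ (hl.mem_Icc a) (hl.eq_zero a hwa) (hl.eq_one a hwa)
    have h3 : (l b - m) * (m - ν a) ≤ (l a - m) * (m - ν a) := by
      by_cases hab : a = b
      · rw [hab]
      have h4 := hS.2.1 a ha hab
      rw [hV] at h4
      have h5 : m ≤ ν a := le_of_mul_le_mul_right h4 hWpos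
      nlinarith [hl.le_best a]
    have h6 := mul_le_mul_of_nonneg_left
      ((div_le_div_of_nonneg_right h3 hmm.le).trans ht) (hw a)
    have e : w a * ((l b - m) * (m - ν a) / (m * (1 - m))) =
      (l b - m) / (m * (1 - m)) * (w a * m - w a * ν a) := by ring
    rw [e] at h6
    linarith
  refine le_trans (le_of_eq ?_) (Finset.sum_le_sum h2)
  rw [Finset.sum_add_distrib, ← Finset.mul_sum, Finset.sum_sub_distrib, ← Finset.sum_mul, hV,
    poolCost]
  ring

lemma exists_isAlternative [Fintype ι] (hw : ∀ a, 0 ≤ w a)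
    (hν : ∀ a, ν a ∈ Set.Icc (0 : ℝ) 1) (hS : IsThreshold w ν b S) :
    ∃ l, IsAlternative w ν b l ∧ ∑ a, w a * kl (ν a) (l a) = poolCost w ν S := by
  classical
  have outside (c : ℝ) (hc : ∀ a ∈ S, w a * kl (ν a) c = w a * kl (ν a) (poolMean w ν S)) :
      ∑ a, w a * kl (ν a) (if a ∈ S then c else ν a) = poolCost w ν S := by
    rw [← Finset.sum_subset (Finset.subset_univ S), poolCost]
    · exact Finset.sum_congr rfl fun a ha => by rw [if_pos ha, hc a ha]
    · intro a _ ha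
      simp [ha]
  by_cases hW : ∑ a ∈ S, w a = 0
  · have h0 : ∀ a ∈ S, w a = 0 := (Finset.sum_eq_zero_iff_of_nonneg fun a _ => hw a).1 hW
    -- With zero total weight the pooled mean is `0` by convention and need not make `b` a best
    -- element. Weightless elements move for free, so they go to `1`.
    refine ⟨fun a => if a ∈ S then 1 else ν a, ⟨?_, ?_, ?_, ?_⟩, outside 1 ?_⟩
    · intro a
      split_ifs
      · simp
      · exact hν a
    · intro a
      simp only [hS.1, if_true]
      split_ifs
      · exact le_rfl
      · exact (hν a).2
    · intro a hwa
      have : a ∉ S := fun h => hwa (h0 a h)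
      simp [this]
    · intro a hwa
      have : a ∉ S := fun h => hwa (h0 a h)
      simp [this]
    · intro a ha
      simp [h0 a ha]
  · have hWpos : 0 < ∑ a ∈ S, w a := (Finset.sum_nonneg fun a _ => hw a).lt_of_ne' hW
    refine ⟨fun a => if a ∈ S then poolMean w ν S else ν a, ⟨?_, ?_, ?_, ?_⟩,
      outside _ fun a _ => rfl⟩
    · intro a
      split_ifs
      · exact poolMean_mem_Icc hw hν
      · exact hν a
    · intro a
      simp only [hS.1, if_true]
      split_ifs with ha
      · exact le_rfl
      · have := hS.2.2 a ha
        rw [sum_mul_eq_poolMean_mul hW] at this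
        exact le_of_mul_le_mul_right this hWpos
    · intro a hwa
      split_ifs with ha
      · exact eq_zero_of_poolMean_eq_zero hw hν ha hwa
      · exact id
    · intro a hwa
      split_ifs with ha
      · exact eq_one_of_poolMean_eq_one hw hν ha hwa
      · exact id

end Pool

/-! ### Evidence: variational form, concavity, continuity, positivity -/

lemma continuousOn_ciInf {ι Y : Type*} [Finite ι] [Nonempty ι] [TopologicalSpace Y]
    {f : ι → Y → ℝ} {s : Set Y} (hf : ∀ i, ContinuousOn (f i) s) :
    ContinuousOn (fun y => ⨅ i, f i y) s := by
  have := Fintype.ofFinite ι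
  simp only [← Finset.inf'_univ_eq_ciInf]
  exact ContinuousOn.finset_inf'_apply Finset.univ_nonempty fun i _ => hf i

lemma add_ciInf_le {ι : Type*} [Finite ι] [Nonempty ι] {f g k : ι → ℝ}
    (h : ∀ i, f i + g i ≤ k i) : (⨅ i, f i) + (⨅ i, g i) ≤ ⨅ i, k i :=
  le_ciInf fun i => (add_le_add (ciInf_le (Set.finite_range f).bddBelow i)
    (ciInf_le (Set.finite_range g).bddBelow i)).trans (h i)

section Evidence

variable {X G H : Type*} [Fintype X] [Fintype G] [Fintype H]

/-- Pairs of a nonnegative weight and a table of means. -/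
def weightedTables (X G H : Type*) : Set ((X × G × H → ℝ) × (X × G × H → ℝ)) :=
  {p | (∀ a, 0 ≤ p.1 a) ∧ ∀ a, p.2 a ∈ Set.Icc (0 : ℝ) 1}

lemma isClosed_weightedTables : IsClosed (weightedTables X G H) := by
  simp only [weightedTables, Set.ofPred_and, Set.ofPred_forall]
  refine IsClosed.inter (isClosed_iInter fun a => ?_) (isClosed_iInter fun a => ?_)
  · exact isClosed_le continuous_const (by fun_prop)
  · exact isClosed_Icc.preimage (f := fun p : (X × G × H → ℝ) × (X × G × H → ℝ) => p.2 a)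
      (by fun_prop)

variable {w w' μ : X × G × H → ℝ} {x : X} {b : G × H}

open scoped Classical in
lemma mem_confusingArms {a : G × H} : a ∈ confusingArms w μ x b ↔ a = b ∨
    wAvg w μ x (insert b (Finset.univ.filter fun a' => μ (x, a) ≤ μ (x, a'))) ≤ μ (x, a) := by
  simp [confusingArms]

/-- The condition "mean at least the average over `b` and the arms no worse" is inherited by better
arms, so `U` is `b` together with an upper level set. Its lowest qualifying arm gives the inequality
inside `U`; the best arm left out gives the one outside. -/
lemma isThreshold_confusingArms (hw : ∀ a, 0 ≤ w a) (hμ : ∀ a, μ a ∈ Set.Icc (0 : ℝ) 1) :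
    IsThreshold (fun a => w (x, a)) (fun a => μ (x, a)) b (confusingArms w μ x b) := by
  classical
  set L : G × H → Finset (G × H) :=
    fun a => insert b (Finset.univ.filter fun a' => μ (x, a) ≤ μ (x, a')) with hL
  have hLmem (a a' : G × H) : a' ∈ L a ↔ a' = b ∨ μ (x, a) ≤ μ (x, a') := by simp [hL]
  have hmem (a : G × H) : a ∈ confusingArms w μ x b ↔ a = b ∨ wAvg w μ x (L a) ≤ μ (x, a) := by
    rw [mem_confusingArms]
  set U := confusingArms w μ x b
  have hb : b ∈ U := (hmem b).2 (Or.inl rfl)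
  have hWnn (S : Finset (G × H)) : 0 ≤ ∑ a ∈ S, w (x, a) := Finset.sum_nonneg fun a _ => hw _
  have avg_le {S : Finset (G × H)} {c : ℝ} (hc : 0 ≤ c) :
      wAvg w μ x S ≤ c ↔ ∑ a ∈ S, w (x, a) * μ (x, a) ≤ c * ∑ a ∈ S, w (x, a) := by
    rcases (hWnn S).eq_or_lt with h | h
    · have h0 : ∀ a ∈ S, w (x, a) = 0 :=
        (Finset.sum_eq_zero_iff_of_nonneg fun a _ => hw (x, a)).1 h.symm
      have h1 : ∑ a ∈ S, w (x, a) * μ (x, a) = 0 :=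
        Finset.sum_eq_zero fun a ha => by rw [h0 a ha, zero_mul]
      simp [wAvg, ← h, h1, hc]
    · rw [wAvg, div_le_iff₀ h]
  -- Passing from `L a` to `L a'` discards arms of mean at least `μ (x, a)`, which cannot push the
  -- average of the rest above that level.
  have upper {a a' : G × H} (ha : wAvg w μ x (L a) ≤ μ (x, a)) (haa' : μ (x, a) ≤ μ (x, a')) :
      wAvg w μ x (L a') ≤ μ (x, a') := by
    rw [avg_le (hμ _).1] at ha ⊢
    have hsub : L a' ⊆ L a := fun c hc => by
      rw [hLmem] at hc ⊢
      exact hc.imp_right haa'.trans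
    rw [← Finset.sum_sdiff hsub, ← Finset.sum_sdiff hsub] at ha
    have hD : μ (x, a) * ∑ c ∈ L a \ L a', w (x, c) ≤
        ∑ c ∈ L a \ L a', w (x, c) * μ (x, c) := by
      rw [Finset.mul_sum]
      refine Finset.sum_le_sum fun c hc => ?_
      rw [Finset.mem_sdiff, hLmem, hLmem] at hc
      rw [mul_comm]
      exact mul_le_mul_of_nonneg_left (hc.1.resolve_left fun h => hc.2 (Or.inl h)) (hw _)
    have := mul_le_mul_of_nonneg_right haa' (hWnn (L a'))
    linarith
  refine ⟨hb, ?_, ?_⟩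
  · intro a ha hab
    have ha' := ((hmem a).1 ha).resolve_left hab
    obtain ⟨a₀, ha₀, hmin⟩ := Finset.exists_min_image
      (Finset.univ.filter fun a => wAvg w μ x (L a) ≤ μ (x, a)) (fun a => μ (x, a))
      ⟨a, by simpa using ha'⟩
    simp only [Finset.mem_filter, Finset.mem_univ, true_and] at ha₀ hmin
    have hU : U = L a₀ := by
      ext c
      rw [hmem, hLmem]
      exact or_congr_right ⟨fun h => hmin c h, fun h => upper ha₀ h⟩
    have h1 := (avg_le (hμ _).1).1 ha₀
    rw [← hU] at h1
    exact h1.trans (mul_le_mul_of_nonneg_right (hmin a ha') (hWnn _))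
  · intro a ha
    by_contra! hlt
    obtain ⟨c, hc, hmax⟩ := Finset.exists_max_image Uᶜ (fun a => μ (x, a))
      ⟨a, Finset.mem_compl.2 ha⟩
    rw [Finset.mem_compl] at hc
    have hac := hmax a (Finset.mem_compl.2 ha)
    -- If the average over `U` were below `μ (x, a)`, the best excluded arm `c` would qualify: the
    -- arms of `L c` outside `U` have means at most that of `c`.
    refine hc ((hmem c).2 (Or.inr ?_))
    rw [avg_le (hμ _).1]
    have hsub : U ⊆ L c := fun d hd => by
      rw [hLmem]
      by_cases hdb : d = b
      · exact Or.inl hdb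
      · refine Or.inr (le_of_not_ge fun h => hc ((hmem c).2 (Or.inr ?_)))
        exact upper (((hmem d).1 hd).resolve_left hdb) h
    rw [← Finset.sum_sdiff hsub, ← Finset.sum_sdiff hsub, mul_add]
    have h1 := mul_le_mul_of_nonneg_right hac (hWnn U)
    refine add_le_add ?_ (hlt.le.trans h1)
    rw [Finset.mul_sum]
    refine Finset.sum_le_sum fun d hd => ?_
    rw [mul_comm]
    exact mul_le_mul_of_nonneg_right
      (hmax d (Finset.mem_compl.2 (Finset.mem_sdiff.1 hd).2)) (hw _)

lemma confusingCost_le_of_isAlternative (hw : ∀ a, 0 ≤ w a) (hμ : ∀ a, μ a ∈ Set.Icc (0 : ℝ) 1)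
    {l : G × H → ℝ} (hl : IsAlternative (fun a => w (x, a)) (fun a => μ (x, a)) b l) :
    confusingCost w μ x b ≤ ∑ a, w (x, a) * kl (μ (x, a)) (l a) :=
  poolCost_le_of_isAlternative (fun _ => hw _) (fun _ => hμ _)
    (isThreshold_confusingArms hw hμ) hl

lemma exists_isAlternative_confusingCost (hw : ∀ a, 0 ≤ w a)
    (hμ : ∀ a, μ a ∈ Set.Icc (0 : ℝ) 1) :
    ∃ l, IsAlternative (fun a => w (x, a)) (fun a => μ (x, a)) b l ∧
      ∑ a, w (x, a) * kl (μ (x, a)) (l a) = confusingCost w μ x b :=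
  exists_isAlternative (fun _ => hw _) (fun _ => hμ _) (isThreshold_confusingArms hw hμ)

/-- Both sides are the same minimum over alternatives, so the choice of threshold set does not
matter. -/
lemma confusingCost_eq_of_isThreshold (hw : ∀ a, 0 ≤ w a) (hμ : ∀ a, μ a ∈ Set.Icc (0 : ℝ) 1)
    {S : Finset (G × H)} (hS : IsThreshold (fun a => w (x, a)) (fun a => μ (x, a)) b S) :
    confusingCost w μ x b = poolCost (fun a => w (x, a)) (fun a => μ (x, a)) S := by
  obtain ⟨l, hl, h⟩ := exists_isAlternative (fun _ => hw _) (fun _ => hμ _) hS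
  obtain ⟨l', hl', h'⟩ := exists_isAlternative_confusingCost (x := x) (b := b) hw hμ
  refine le_antisymm ?_ ?_
  · rw [← h]
    exact confusingCost_le_of_isAlternative hw hμ hl
  · rw [← h']
    exact poolCost_le_of_isAlternative (fun _ => hw _) (fun _ => hμ _) hS hl'

/-- An optimal alternative for `w + w'` is admissible for each of `w` and `w'`, and its cost is
additive in the weights. -/
lemma confusingCost_add_le (hw : ∀ a, 0 ≤ w a) (hw' : ∀ a, 0 ≤ w' a)
    (hμ : ∀ a, μ a ∈ Set.Icc (0 : ℝ) 1) :
    confusingCost w μ x b + confusingCost w' μ x b ≤ confusingCost (w + w') μ x b := by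
  obtain ⟨l, hl, h⟩ := exists_isAlternative_confusingCost (w := w + w') (x := x) (b := b)
    (fun a => add_nonneg (hw a) (hw' a)) hμ
  have aux {v : X × G × H → ℝ} (hv : ∀ a, v a ≠ 0 → (w + w') a ≠ 0) :
      IsAlternative (fun a => v (x, a)) (fun a => μ (x, a)) b l :=
    ⟨hl.mem_Icc, hl.le_best, fun a ha => hl.eq_zero a (hv _ ha),
      fun a ha => hl.eq_one a (hv _ ha)⟩
  have h1 := confusingCost_le_of_isAlternative hw hμ (aux fun a ha h0 =>
    ha ((add_eq_zero_iff_of_nonneg (hw a) (hw' a)).1 h0).1)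
  have h2 := confusingCost_le_of_isAlternative hw' hμ (aux fun a ha h0 =>
    ha ((add_eq_zero_iff_of_nonneg (hw a) (hw' a)).1 h0).2)
  rw [← h]
  simp only [Pi.add_apply, add_mul, Finset.sum_add_distrib]
  exact add_le_add h1 h2

lemma wAvg_smul {c : ℝ} (hc : c ≠ 0) (S : Finset (G × H)) :
    wAvg (c • w) μ x S = wAvg w μ x S := by
  simp only [wAvg, Pi.smul_apply, smul_eq_mul, mul_assoc, ← Finset.mul_sum]
  exact mul_div_mul_left _ _ hc

lemma confusingCost_smul {c : ℝ} (hc : c ≠ 0) :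
    confusingCost (c • w) μ x b = c * confusingCost w μ x b := by
  have h : confusingArms (c • w) μ x b = confusingArms w μ x b := by
    ext a
    rw [mem_confusingArms, mem_confusingArms, wAvg_smul hc]
  simp only [confusingCost, confusingMean, h, wAvg_smul hc]
  simp only [Pi.smul_apply, smul_eq_mul, mul_assoc, ← Finset.mul_sum]

/-- The set `U` jumps and `kl` is singular at the boundary, so the domain is covered by finitely
many closed pieces, one per threshold set. On each piece the cost is a combination of `negMulLog`
and `binEntropy`, which are continuous up to the boundary. -/
lemma continuousOn_confusingCost (x : X) (b : G × H) :
    ContinuousOn (fun p : (X × G × H → ℝ) × (X × G × H → ℝ) => confusingCost p.1 p.2 x b)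
      (weightedTables X G H) := by
  have hcov : weightedTables X G H = ⋃ S : Finset (G × H), {p | p ∈ weightedTables X G H ∧
      IsThreshold (fun a => p.1 (x, a)) (fun a => p.2 (x, a)) b S} := by
    ext p
    simp only [Set.mem_iUnion, Set.mem_ofPred_eq]
    exact ⟨fun h => ⟨_, h, isThreshold_confusingArms h.1 h.2⟩, fun ⟨_, h, _⟩ => h⟩
  rw [hcov]
  refine (locallyFinite_of_finite _).continuousOn_iUnion (fun S => ?_) fun S => ?_
  · simp only [IsThreshold, Set.ofPred_and, Set.ofPred_forall]
    refine isClosed_weightedTables.inter (isClosed_const.inter (IsClosed.inter ?_ ?_))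
    · refine isClosed_iInter fun a => isClosed_iInter fun _ => isClosed_iInter fun _ => ?_
      exact isClosed_le (by fun_prop) (by fun_prop)
    · refine isClosed_iInter fun a => isClosed_iInter fun _ => ?_
      exact isClosed_le (by fun_prop) (by fun_prop)
  · refine ContinuousOn.congr (f := fun p => Real.negMulLog (∑ a ∈ S, p.1 (x, a) * p.2 (x, a))
      + Real.negMulLog (∑ a ∈ S, p.1 (x, a) - ∑ a ∈ S, p.1 (x, a) * p.2 (x, a))
      - Real.negMulLog (∑ a ∈ S, p.1 (x, a))
      - ∑ a ∈ S, p.1 (x, a) * Real.binEntropy (p.2 (x, a))) ?_ ?_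
    · have := Real.binEntropy_continuous
      have := Real.continuous_negMulLog
      exact Continuous.continuousOn (by fun_prop)
    · rintro p ⟨hp, hS⟩
      dsimp only
      rw [confusingCost_eq_of_isThreshold hp.1 hp.2 hS,
        poolCost_eq (fun _ => hp.1 _) (fun _ => hp.2 _)]

variable [Nontrivial G] [Nonempty H]

instance nonempty_ne (g : G) : Nonempty {g' : G // g' ≠ g} :=
  let ⟨g', h⟩ := exists_ne g
  ⟨⟨g', h⟩⟩

lemma continuousOn_evidence (g : G) :
    ContinuousOn (fun p : (X × G × H → ℝ) × (X × G × H → ℝ) => evidence g p.1 p.2)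
      (weightedTables X G H) :=
  continuousOn_ciInf fun g' => continuousOn_finsetSum _ fun x _ =>
    continuousOn_ciInf fun h => continuousOn_confusingCost x (g'.1, h)

lemma evidence_add_le (g : G) (hw : ∀ a, 0 ≤ w a) (hw' : ∀ a, 0 ≤ w' a)
    (hμ : ∀ a, μ a ∈ Set.Icc (0 : ℝ) 1) :
    evidence g w μ + evidence g w' μ ≤ evidence g (w + w') μ :=
  add_ciInf_le fun g' => by
    rw [← Finset.sum_add_distrib]
    exact Finset.sum_le_sum fun x _ => add_ciInf_le fun h => confusingCost_add_le hw hw' hμ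

lemma evidence_smul (g : G) {c : ℝ} (hc : 0 < c) :
    evidence g (c • w) μ = c * evidence g w μ := by
  simp only [evidence, confusingCost_smul hc.ne', Real.mul_iInf_of_nonneg hc.le, Finset.mul_sum]

/-- With positive weights, zero cost forces the optimal alternative to equal `μ`, for which `b` is
not a best arm. -/
lemma confusingCost_pos (hw : ∀ a, 0 < w a) (hμ : ∀ a, μ a ∈ Set.Icc (0 : ℝ) 1)
    {a : G × H} (hb : μ (x, b) < μ (x, a)) : 0 < confusingCost w μ x b := by
  have hw0 := fun a => (hw a).le
  obtain ⟨l, hl, h⟩ := exists_isAlternative_confusingCost (x := x) (b := b) hw0 hμ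
  have hkl (a) : 0 ≤ kl (μ (x, a)) (l a) := kl_nonneg (hμ _) (hl.mem_Icc a)
    (hl.eq_zero a (hw _).ne') (hl.eq_one a (hw _).ne')
  have hne : ∃ c, μ (x, c) ≠ l c := by
    by_contra! hc
    have := hl.le_best a
    rw [← hc, ← hc] at this
    exact this.not_gt hb
  obtain ⟨c, hc⟩ := hne
  rw [← h]
  exact Finset.sum_pos' (fun a _ => mul_nonneg (hw0 _) (hkl a)) ⟨c, Finset.mem_univ _,
    mul_pos (hw _) (kl_pos (hμ _) (hl.mem_Icc c) (hl.eq_zero c (hw _).ne')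
      (hl.eq_one c (hw _).ne') hc)⟩

lemma evidence_pos [Nonempty X] {g : G} {h : X → H} (hw : ∀ a, 0 < w a)
    (hμ : ∀ a, μ a ∈ Set.Icc (0 : ℝ) 1) (hopt : IsOptimal μ g h) : 0 < evidence g w μ := by
  obtain ⟨g', hg'⟩ := exists_eq_ciInf_of_finite
    (f := fun g' : {g' : G // g' ≠ g} => ∑ x : X, ⨅ h : H, confusingCost w μ x (g'.1, h))
  rw [evidence, ← hg']
  refine Finset.sum_pos (fun x _ => ?_) Finset.univ_nonempty
  obtain ⟨h', hh'⟩ := exists_eq_ciInf_of_finite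
    (f := fun h : H => confusingCost w μ x (g'.1, h))
  rw [← hh']
  exact confusingCost_pos hw hμ (hopt x (g'.1, h') fun e => g'.2 (congrArg Prod.fst e))

end Evidence

/-! ### Regularized optimal allocations -/

section Allocation

variable {X G H : Type*} [Fintype X] [Fintype G] [Fintype H] [Nonempty X] [Nontrivial G]
  [Nonempty H] {μ ν q : X × G × H → ℝ} {g : G} {h : X → H} {σ : ℝ}

lemma IsOptimal.optRep_eq (hμ : IsOptimal μ g h) : optRep μ = g := by
  have hex : ∃ g, ∃ h : X → H, IsOptimal μ g h := ⟨g, h, hμ⟩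
  obtain ⟨h', hopt⟩ : ∃ h' : X → H, IsOptimal μ (optRep μ) h' := Classical.epsilon_spec hex
  by_contra hne
  obtain ⟨x⟩ := ‹Nonempty X›
  have h1 := hμ x (optRep μ, h' x) fun e => hne (congrArg Prod.fst e)
  have h2 := hopt x (g, h x) fun e => hne (congrArg Prod.fst e).symm
  exact lt_asymm h1 h2

lemma isOpen_setOf_isOptimal (g : G) (h : X → H) :
    IsOpen {μ : X × G × H → ℝ | IsOptimal μ g h} := by
  simp only [IsOptimal, Set.ofPred_forall]
  exact isOpen_iInter_of_finite fun x => isOpen_iInter_of_finite fun a =>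
    isOpen_iInter_of_finite fun _ => isOpen_lt (by fun_prop) (by fun_prop)

lemma continuousOn_rhoReg (σ : ℝ) (hμ : ∀ a, μ a ∈ Set.Icc (0 : ℝ) 1) :
    ContinuousOn (fun q => rhoReg σ q μ) (stdSimplex ℝ (X × G × H)) := by
  refine ContinuousOn.sub ?_ (Continuous.continuousOn (by fun_prop))
  exact (continuousOn_evidence (optRep μ)).comp (f := fun q => (q, μ))
    (Continuous.continuousOn (by fun_prop)) fun q hq => ⟨hq.1, hμ⟩

lemma exists_isOptAlloc (σ : ℝ) (hμ : ∀ a, μ a ∈ Set.Icc (0 : ℝ) 1) :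
    ∃ q, IsOptAlloc σ μ q := by
  classical
  obtain ⟨q, hq, hmax⟩ := (isCompact_stdSimplex ℝ (X × G × H)).exists_isMaxOn
    ⟨Pi.single (Classical.arbitrary _) 1, single_mem_stdSimplex ℝ _⟩ (continuousOn_rhoReg σ hμ)
  exact ⟨q, hq, hmax⟩

/-- Strong concavity tested at the midpoint of `q` and `q'`: `ρ` is concave, and the parallelogram
identity for the penalty gains `‖q' - q‖² / (8σ)`, which optimality of `q` bounds by `ε / 2`. -/
lemma sq_sub_le_of_rhoReg (hσ : 0 < σ) (hμ : ∀ a, μ a ∈ Set.Icc (0 : ℝ) 1)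
    {q' : X × G × H → ℝ} (hq : IsOptAlloc σ μ q) (hq' : q' ∈ stdSimplex ℝ (X × G × H)) {ε : ℝ}
    (hε : rhoReg σ q μ ≤ rhoReg σ q' μ + ε) (a : X × G × H) :
    (q' a - q a) ^ 2 ≤ 4 * σ * ε := by
  have h2 : (0 : ℝ) < 1 / 2 := by norm_num
  have hmid : (1 / 2 : ℝ) • q' + (1 / 2 : ℝ) • q ∈ stdSimplex ℝ (X × G × H) :=
    convex_stdSimplex ℝ _ hq' hq.1 h2.le h2.le (by norm_num)
  have hle := hq.2 _ hmid
  have hrho : (1 / 2) * rho q' μ + (1 / 2) * rho q μ ≤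
      rho ((1 / 2 : ℝ) • q' + (1 / 2 : ℝ) • q) μ := by
    rw [rho, rho, ← evidence_smul _ h2, ← evidence_smul _ h2]
    exact evidence_add_le _ (fun a => mul_nonneg h2.le (hq'.1 a))
      (fun a => mul_nonneg h2.le (hq.1.1 a)) hμ
  have hsq : ∑ a, ((1 / 2 : ℝ) • q' + (1 / 2 : ℝ) • q) a ^ 2 =
      (1 / 2) * ∑ a, q' a ^ 2 + (1 / 2) * ∑ a, q a ^ 2 - (1 / 4) * ∑ a, (q' a - q a) ^ 2 := by
    simp only [Finset.mul_sum, ← Finset.sum_add_distrib, ← Finset.sum_sub_distrib]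
    refine Finset.sum_congr rfl fun a _ => ?_
    simp only [Pi.add_apply, Pi.smul_apply, smul_eq_mul]
    ring
  have hone : (q' a - q a) ^ 2 ≤ ∑ a, (q' a - q a) ^ 2 :=
    Finset.single_le_sum (f := fun a => (q' a - q a) ^ 2) (fun _ _ => sq_nonneg _)
      (Finset.mem_univ a)
  unfold rhoReg at hle hε
  rw [hsq] at hle
  set D := ∑ a, (q' a - q a) ^ 2
  have e : ((1 / 2) * ∑ a, q' a ^ 2 + (1 / 2) * ∑ a, q a ^ 2 - (1 / 4) * D) / (2 * σ) =
    (1 / 2) * ((∑ a, q' a ^ 2) / (2 * σ)) + (1 / 2) * ((∑ a, q a ^ 2) / (2 * σ)) -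
      D / (8 * σ) := by
    field_simp; ring
  rw [e] at hle
  have hD : D / (8 * σ) ≤ ε / 2 := by linarith
  rw [div_le_iff₀ (by positivity)] at hD
  linarith

/-- The uniform allocation has positive `ρ` and the least norm in the simplex, so an allocation with
`ρ ≤ 0` cannot beat it. This works for every `σ > 0`, even when the maximum of `ρ_σ` is not
positive. -/
lemma rho_pos (hσ : 0 < σ) (hμ : μ ∈ models X G H) (hq : IsOptAlloc σ μ q) : 0 < rho q μ := by
  classical
  obtain ⟨hμ01, g, h, hopt⟩ := hμ
  by_contra! hle
  set N : ℝ := ((Fintype.card (X × G × H) : ℕ) : ℝ)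
  have hN : 0 < N := by simp only [N]; exact_mod_cast Fintype.card_pos
  set u : X × G × H → ℝ := fun _ => 1 / N
  have hu : u ∈ stdSimplex ℝ (X × G × H) :=
    ⟨fun _ => by positivity, by
      simp only [u, Finset.sum_const, Finset.card_univ, nsmul_eq_mul]
      exact mul_one_div_cancel hN.ne'⟩
  have hpos : 0 < rho u μ := by
    rw [rho, hopt.optRep_eq]
    exact evidence_pos (fun _ => by simp only [u]; positivity) hμ01 hopt
  have h1 := hq.2 u hu
  have hcs : ∑ a, u a ^ 2 ≤ ∑ a, q a ^ 2 := by
    have h2 : 0 ≤ ∑ a, (q a - 1 / N) ^ 2 := Finset.sum_nonneg fun _ _ => sq_nonneg _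
    have h3 : ∑ a, (q a - 1 / N) ^ 2 = ∑ a, q a ^ 2 - ∑ a, u a ^ 2 := by
      have e (a) : (q a - 1 / N) ^ 2 = q a ^ 2 - (2 / N) * q a + (1 / N) ^ 2 := by ring
      simp only [e, Finset.sum_add_distrib, Finset.sum_sub_distrib, ← Finset.mul_sum, hq.1.2, u,
        Finset.sum_const, Finset.card_univ, nsmul_eq_mul]
      change _ - _ + N * _ = _ - N * _
      field_simp; ring
    linarith
  have h4 := div_le_div_of_nonneg_right hcs (by positivity : 0 ≤ 2 * σ)
  unfold rhoReg at h1
  linarith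

/-- The optimal allocation depends continuously on the model. -/
lemma exists_forall_isOptAlloc_near (hσ : 0 < σ) (hμ : μ ∈ models X G H)
    (hq : IsOptAlloc σ μ q) {ε : ℝ} (hε : 0 < ε) :
    ∃ ξ > 0, ∀ ν : X × G × H → ℝ, (∀ a, ν a ∈ Set.Icc (0 : ℝ) 1) → (∀ a, |ν a - μ a| ≤ ξ) →
      ν ∈ models X G H ∧ ∀ q', IsOptAlloc σ ν q' → ∀ a, |q' a - q a| ≤ ε := by
  obtain ⟨hμ01, g, h, hopt⟩ := hμ
  obtain ⟨r, hr, hball⟩ := Metric.isOpen_iff.1 (isOpen_setOf_isOptimal g h) μ hopt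
  set cube : Set (X × G × H → ℝ) := Set.univ.pi fun _ => Set.Icc (0 : ℝ) 1
  have hcomp : IsCompact (stdSimplex ℝ (X × G × H) ×ˢ cube) :=
    (isCompact_stdSimplex ℝ _).prod (isCompact_univ_pi fun _ => isCompact_Icc)
  have hcont : ContinuousOn
      (fun p : (X × G × H → ℝ) × (X × G × H → ℝ) => evidence g p.1 p.2)
      (stdSimplex ℝ (X × G × H) ×ˢ cube) :=
    (continuousOn_evidence g).mono fun p hp => ⟨hp.1.1, fun a => hp.2 a trivial⟩
  have huc := Metric.uniformContinuousOn_iff.1 (hcomp.uniformContinuousOn_of_continuous hcont)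
  set ε₀ := ε ^ 2 / (8 * σ) with hε₀
  have hε₀pos : 0 < ε₀ := by positivity
  obtain ⟨d, hd, hclose⟩ := huc ε₀ hε₀pos
  refine ⟨min r d / 2, by positivity, fun ν hν hνμ => ?_⟩
  have hmin : 0 < min r d := lt_min hr hd
  have hdist : dist ν μ < min r d :=
    ((dist_pi_le_iff (by positivity)).2 fun a => by
      rw [Real.dist_eq]; exact hνμ a).trans_lt (half_lt_self hmin)
  have hνopt : IsOptimal ν g h := hball (hdist.trans_le (min_le_left _ _))
  refine ⟨⟨hν, g, h, hνopt⟩, fun q' hq' a => ?_⟩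
  -- Uniform continuity on a compact set makes one `ξ` serve all allocations. Hence a maximizer for
  -- `ν` is `2ε₀`-optimal for `μ`, and `ε₀` is chosen so that `4σ · 2ε₀ = ε²`.
  have hdiff {p : X × G × H → ℝ} (hp : p ∈ stdSimplex ℝ (X × G × H)) :
      |rhoReg σ p ν - rhoReg σ p μ| < ε₀ := by
    have := hclose (p, ν) ⟨hp, fun a _ => hν a⟩ (p, μ) ⟨hp, fun a _ => hμ01 a⟩ (by
      rw [dist_prod_same_left]; exact hdist.trans_le (min_le_right _ _))
    rw [Real.dist_eq] at this
    simpa [rhoReg, rho, hνopt.optRep_eq, hopt.optRep_eq] using this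
  have h1 := abs_lt.1 (hdiff hq.1)
  have h2 := abs_lt.1 (hdiff hq'.1)
  have h3 := hq'.2 q hq.1
  have h4 := sq_sub_le_of_rhoReg hσ hμ01 hq hq'.1 (ε := 2 * ε₀) (by linarith) a
  have h5 : 4 * σ * (2 * ε₀) = ε ^ 2 := by rw [hε₀]; field_simp; norm_num
  rw [h5] at h4
  exact abs_le_of_sq_le_sq h4 hε.le

lemma exists_forall_rho_sub_lt_evidence (hμ : ∀ a, μ a ∈ Set.Icc (0 : ℝ) 1)
    (hopt : IsOptimal μ g h) (hq : q ∈ stdSimplex ℝ (X × G × H)) {ε : ℝ} (hε : 0 < ε) :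
    ∃ ξ > 0, ∀ w ν : X × G × H → ℝ, (∀ a, 0 ≤ w a) → (∀ a, ν a ∈ Set.Icc (0 : ℝ) 1) →
      (∀ a, |w a - q a| ≤ ξ) → (∀ a, |ν a - μ a| ≤ ξ) → rho q μ - ε < evidence g w ν := by
  obtain ⟨d, hd, hclose⟩ := Metric.continuousWithinAt_iff.1
    (continuousOn_evidence g (q, μ) ⟨hq.1, hμ⟩) ε hε
  refine ⟨d / 2, by positivity, fun w ν hw hν hwq hνμ => ?_⟩
  have hdist {v v' : X × G × H → ℝ} (hv : ∀ a, |v a - v' a| ≤ d / 2) : dist v v' < d :=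
    ((dist_pi_le_iff (by positivity)).2 fun a => by
      rw [Real.dist_eq]; exact hv a).trans_lt (half_lt_self hd)
  have := hclose (x := (w, ν)) ⟨hw, hν⟩ (max_lt (hdist hwq) (hdist hνμ))
  rw [Real.dist_eq] at this
  rw [rho, hopt.optRep_eq]
  linarith [(abs_lt.1 this).1]

end Allocation

/-! ### Pathwise analysis of the sampling rule -/

section Tracking

variable {X G H Ω : Type*} {A : ℕ → Ω → X × G × H} {R : ℕ → Ω → ℝ} {ω : Ω}

open scoped Classical in
lemma count_succ (t : ℕ) (a : X × G × H) :
    count A (t + 1) ω a = count A t ω a + if A t ω = a then 1 else 0 := by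
  simp only [count, Finset.range_add_one, Finset.filter_insert]
  split_ifs with h
  · rw [Finset.card_insert_of_notMem (by simp)]
    push_cast
    rfl
  · simp

@[simp] lemma count_zero (a : X × G × H) : count A 0 ω a = 0 := by simp [count]

lemma count_nonneg (t : ℕ) (a : X × G × H) : 0 ≤ count A t ω a := Nat.cast_nonneg _

lemma count_mono (a : X × G × H) : Monotone fun t => count A t ω a :=
  monotone_nat_of_le_succ fun t => by
    rw [count_succ]
    split_ifs <;> simp

open scoped Classical in
/-- Sum of the centered rewards of arm `a` over the first `t` rounds. -/
noncomputable def deviation (A : ℕ → Ω → X × G × H) (R : ℕ → Ω → ℝ) (μ : X × G × H → ℝ) (t : ℕ) (ω : Ω)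
    (a : X × G × H) : ℝ :=
  ∑ s ∈ Finset.range t, if A s ω = a then R s ω - μ a else 0

lemma empMean_sub {μ : X × G × H → ℝ} {t : ℕ} {a : X × G × H} (hc : 0 < count A t ω a) :
    empMean A R t ω a - μ a = deviation A R μ t ω a / count A t ω a := by
  rw [empMean, eq_div_iff hc.ne', sub_mul, div_mul_cancel₀ _ hc.ne', deviation,
    ← Finset.sum_filter, Finset.sum_sub_distrib, Finset.sum_const, nsmul_eq_mul, count]
  ring

lemma empMean_mem_Icc (hR : ∀ t ω, R t ω = 0 ∨ R t ω = 1) (t : ℕ) (a : X × G × H) :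
    empMean A R t ω a ∈ Set.Icc (0 : ℝ) 1 := by
  have h (s) : R s ω ∈ Set.Icc (0 : ℝ) 1 := by rcases hR s ω with h | h <;> simp [h]
  refine ⟨div_nonneg (Finset.sum_nonneg fun s _ => (h s).1) (count_nonneg _ _),
    div_le_one_of_le₀ ?_ (count_nonneg _ _)⟩
  refine (Finset.sum_le_sum fun s _ => (h s).2).trans (le_of_eq ?_)
  simp [count]

variable [Fintype X] [Fintype G] [Fintype H]

lemma sum_count (t : ℕ) : ∑ a, count A t ω a = t := by
  classical
  induction t with
  | zero => simp
  | succ t ih =>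
    simp only [count_succ, Finset.sum_add_distrib, ih]
    simp

lemma count_le (t : ℕ) (a : X × G × H) : count A t ω a ≤ t := by
  rw [← sum_count (A := A) (ω := ω) t]
  exact Finset.single_le_sum (fun a _ => count_nonneg t a) (Finset.mem_univ a)

variable [Nonempty G] {σ : ℝ}

/-- Forced exploration. -/
lemma IsTracking.min_le_count (hA : IsTracking σ A R) (t : ℕ) (a : X × G × H) :
    min (Real.sqrt t / 2 - (Fintype.card (X × G × H) : ℝ) / 2)
      ((3 * t / 4 - 1) / (Fintype.card (X × G × H) : ℝ) - 1) ≤ count A t ω a := by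
  classical
  rw [min_le_iff, or_iff_not_imp_left, not_le]
  intro hlt
  set n := count A t ω a
  -- Potential argument. If `a` has few plays at time `t`, it is undersampled at every round `s`
  -- with `t/4 ≤ s < t`. The arm played there has count at most `n`, so the cap `n + 1` is inactive
  -- and `Φ` grows by one. Since `Φ ≤ K (n + 1)`, this forces `n` to be of order `t / K`.
  set Φ : ℕ → ℝ := fun s => ∑ a', min (count A s ω a') (n + 1)
  have hn : 0 ≤ n := count_nonneg t a
  have hΦ0 (s) : 0 ≤ Φ s := Finset.sum_nonneg fun a' _ =>
    le_min (count_nonneg s a') (by linarith)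
  have hstep (s : ℕ) (hst : s < t) (hs4 : (t : ℝ) ≤ 4 * s) : Φ s + 1 ≤ Φ (s + 1) := by
    have hcs : count A s ω a ≤ n := count_mono a hst.le
    have hsqrt : Real.sqrt t / 2 ≤ Real.sqrt s := by
      have h2 : Real.sqrt t ≤ Real.sqrt (2 ^ 2 * s) := Real.sqrt_le_sqrt (by linarith)
      rw [Real.sqrt_mul (by norm_num), Real.sqrt_sq (by norm_num)] at h2
      linarith
    have haU : count A s ω a < Real.sqrt s - (Fintype.card (X × G × H) : ℝ) / 2 := by linarith
    have hplay := ((hA s ω).1 ⟨a, haU⟩).2 a haU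
    have hsum : Φ (s + 1) = Φ s + ∑ a', if A s ω = a' then (1 : ℝ) else 0 := by
      simp only [Φ, ← Finset.sum_add_distrib]
      refine Finset.sum_congr rfl fun a' _ => ?_
      rw [count_succ]
      split_ifs with h
      · subst h
        rw [min_eq_left (by linarith), min_eq_left (by linarith)]
      · simp
    rw [hsum]
    simp
  have hall (s : ℕ) (hst : s ≤ t) : (s : ℝ) - t / 4 - 1 ≤ Φ s := by
    induction s with
    | zero =>
      have := hΦ0 0
      have : (0 : ℝ) ≤ t := Nat.cast_nonneg t
      push_cast
      linarith
    | succ s ih =>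
      have hs := ih (by omega)
      push_cast
      rcases le_total (t : ℝ) (4 * s) with h | h
      · linarith [hstep s (by omega) h]
      · linarith [hΦ0 (s + 1)]
  have hup : Φ t ≤ (Fintype.card (X × G × H) : ℝ) * (n + 1) := by
    refine (Finset.sum_le_sum fun a' _ => min_le_right _ _).trans (le_of_eq ?_)
    rw [Finset.sum_const, Finset.card_univ, nsmul_eq_mul]
  have hK : (0 : ℝ) < Fintype.card (X × G × H) := by
    exact_mod_cast Fintype.card_pos_iff.2 ⟨a⟩
  rw [sub_le_iff_le_add, div_le_iff₀ hK]
  linarith [hall t le_rfl]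

lemma IsTracking.sqrt_div_le_count (hA : IsTracking σ A R) {t : ℕ}
    (ht : 2 * (Fintype.card (X × G × H) : ℝ) + 4 ≤ Real.sqrt t) (a : X × G × H) :
    Real.sqrt t / 4 ≤ count A t ω a := by
  refine le_trans (le_min ?_ ?_) (hA.min_le_count t a)
  · linarith
  · have hK : (1 : ℝ) ≤ Fintype.card (X × G × H) := by
      exact_mod_cast Fintype.card_pos_iff.2 ⟨a⟩
    have hs : Real.sqrt t * Real.sqrt t = t := Real.mul_self_sqrt (Nat.cast_nonneg t)
    rw [le_sub_iff_add_le, le_div_iff₀ (by linarith)]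
    nlinarith

/-- An arm is played either by forced exploration, with count below `√s`, or because it maximizes `s
q' - N_s`. These gaps sum to zero, so the maximal one is nonnegative and the count is at most `s q'
a`. One play overshoots by one, and the rounds before `t₀` cost at most `t₀`. -/
lemma IsTracking.count_le_add (hA : IsTracking σ A R) {q : X × G × H → ℝ}
    (hq : ∀ a, 0 ≤ q a) {ε : ℝ} (hε : 0 ≤ ε) {t₀ : ℕ}
    (h : ∀ t, t₀ ≤ t → empMean A R t ω ∈ models X G H ∧
      ∀ q', IsOptAlloc σ (empMean A R t ω) q' → ∀ a, |q' a - q a| ≤ ε)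
    {t : ℕ} (ht : t₀ ≤ t) (a : X × G × H) :
    count A t ω a ≤ t₀ + 1 + Real.sqrt t + t * (q a + ε) := by
  have hqa : 0 ≤ q a + ε := add_nonneg (hq a) hε
  induction t, ht using Nat.le_induction with
  | base =>
    have := count_le (A := A) (ω := ω) t₀ a
    have := Real.sqrt_nonneg t₀
    have : 0 ≤ t₀ * (q a + ε) := by positivity
    linarith
  | succ s hs ih =>
    have hsqrt : Real.sqrt s ≤ Real.sqrt (s + 1 : ℕ) :=
      Real.sqrt_le_sqrt (by push_cast; linarith)
    have hlin : s * (q a + ε) ≤ (s + 1 : ℕ) * (q a + ε) :=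
      mul_le_mul_of_nonneg_right (by push_cast; linarith) hqa
    rw [count_succ]
    split_ifs with hplay
    · have key : count A s ω a ≤ Real.sqrt s + s * (q a + ε) := by
        have h0 : 0 ≤ s * (q a + ε) := by positivity
        by_cases hU : ({a | count A s ω a < Real.sqrt s -
            (Fintype.card (X × G × H) : ℝ) / 2} : Set (X × G × H)).Nonempty
        · have h1 : count A s ω (A s ω) < Real.sqrt s - (Fintype.card (X × G × H) : ℝ) / 2 :=
            ((hA s ω).1 hU).1
          rw [hplay] at h1
          have : (0 : ℝ) ≤ Fintype.card (X × G × H) := Nat.cast_nonneg _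
          linarith
        · obtain ⟨q', hq', hopt, hmax⟩ := (hA s ω).2 hU
          obtain ⟨hmod, hnear⟩ := h s hs
          have h1 := (abs_le.1 (hnear q' (hopt hmod) a)).2
          rw [hplay] at hmax
          have h2 : 0 ≤ s * q' a - count A s ω a := by
            by_contra! hneg
            have h3 : ∑ a', (s * q' a' - count A s ω a') < ∑ _a' : X × G × H, (0 : ℝ) :=
              Finset.sum_lt_sum_of_nonempty ⟨a, Finset.mem_univ a⟩ fun a' _ =>
                (hmax a').trans_lt hneg
            rw [Finset.sum_sub_distrib, ← Finset.mul_sum, hq'.2, sum_count] at h3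
            simp at h3
          have h4 : s * q' a ≤ s * (q a + ε) :=
            mul_le_mul_of_nonneg_left (by linarith) (Nat.cast_nonneg s)
          linarith [Real.sqrt_nonneg s]
      have : (0 : ℝ) ≤ t₀ := Nat.cast_nonneg _
      linarith
    · linarith

/-- The upper bounds imply the lower ones: counts and `t q` both sum to `t`, so the deficit of one
arm is at most the total slack `3Kεt` of the upper bounds. -/
lemma IsTracking.abs_count_sub_le (hA : IsTracking σ A R) {q : X × G × H → ℝ}
    (hq : q ∈ stdSimplex ℝ (X × G × H)) {ε : ℝ} (hε : 0 ≤ ε) {t₀ : ℕ}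
    (h : ∀ t, t₀ ≤ t → empMean A R t ω ∈ models X G H ∧
      ∀ q', IsOptAlloc σ (empMean A R t ω) q' → ∀ a, |q' a - q a| ≤ ε)
    {t : ℕ} (ht : t₀ ≤ t) (ht1 : (t₀ : ℝ) + 1 ≤ ε * t) (ht2 : Real.sqrt t ≤ ε * t)
    (a : X × G × H) :
    |count A t ω a - t * q a| ≤ 3 * (Fintype.card (X × G × H) : ℝ) * ε * t := by
  classical
  have hup (a) : count A t ω a ≤ t * q a + 3 * ε * t := by
    have := hA.count_le_add hq.1 hε h ht a
    linarith
  have hK : (1 : ℝ) ≤ Fintype.card (X × G × H) := by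
    exact_mod_cast Fintype.card_pos_iff.2 ⟨a⟩
  have hεt : 0 ≤ ε * t := by positivity
  have hnn (a) : 0 ≤ t * q a + 3 * ε * t - count A t ω a := by linarith [hup a]
  have hlow := Finset.single_le_sum (fun a _ => hnn a) (Finset.mem_univ a)
  rw [Finset.sum_sub_distrib, Finset.sum_add_distrib, ← Finset.mul_sum, hq.2, sum_count,
    Finset.sum_const, Finset.card_univ, nsmul_eq_mul] at hlow
  rw [abs_le]
  constructor
  · nlinarith [hnn a]
  · nlinarith [hup a]

end Tracking

/-! ### Linear growth of the stopping statistic -/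

section Evidence

variable {X G H Ω : Type*} [Fintype X] [Fintype G] [Fintype H] [Nonempty X] [Nontrivial G]
  [Nonempty H] {μ q : X × G × H → ℝ} {A : ℕ → Ω → X × G × H} {R : ℕ → Ω → ℝ} {σ : ℝ}

/-- Linear growth of the stopping statistic after the empirical means have settled. -/
lemma IsTracking.exists_forall_lt_Psi (hA : IsTracking σ A R) (hσ : 0 < σ)
    (hμ : μ ∈ models X G H) (hR : ∀ t ω, R t ω = 0 ∨ R t ω = 1) (hq : IsOptAlloc σ μ q)
    {ε : ℝ} (hε : 0 < ε) :
    ∃ ξ > 0, ξ ≤ 1 ∧ ∃ c > 0, ∀ (ω : Ω) (t₀ : ℕ),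
      (∀ t, t₀ ≤ t → ∀ a, |deviation A R μ t ω a| ≤ ξ * count A t ω a) →
      ∀ t : ℕ, c * (t₀ + 1 : ℝ) ≤ t → ∃ g, (rho q μ - ε) * t < Psi A R t ω g := by
  obtain ⟨hμ01, g, h, hopt⟩ := id hμ
  obtain ⟨ξ₁, hξ₁, hev⟩ := exists_forall_rho_sub_lt_evidence hμ01 hopt hq.1 hε
  set K : ℝ := ((Fintype.card (X × G × H) : ℕ) : ℝ)
  have hK : 0 < K := by simp only [K]; exact_mod_cast Fintype.card_pos
  -- Chosen so that the tracking error `3Kε'` equals `ξ₁`.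
  set ε' := ξ₁ / (3 * K) with hε'
  have hε'pos : 0 < ε' := by positivity
  obtain ⟨ξ₂, hξ₂, hal⟩ := exists_forall_isOptAlloc_near hσ hμ hq hε'pos
  obtain ⟨T, hT⟩ := exists_nat_ge ((2 * K + 4) ^ 2)
  -- The three summands make `t ≥ c (t₀ + 1)` imply `t₀ + T ≤ t`, `t₀ + T + 1 ≤ ε' t` and `√t ≤ ε'
  -- t`. Linearity in `t₀`, with `c` independent of `ω`, allows taking expectations later.
  have hc : (0 : ℝ) < T + (T + 1) / ε' + 1 / ε' ^ 2 := by positivity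
  refine ⟨min (min ξ₁ ξ₂) 1, by positivity, min_le_right _ _, _, hc, ?_⟩
  intro ω t₀ hdev t ht
  have hT' {s : ℕ} (hs : T ≤ s) : 2 * K + 4 ≤ Real.sqrt s :=
    Real.le_sqrt_of_sq_le (hT.trans (by exact_mod_cast hs))
  have hmean (s : ℕ) (hs : t₀ + T ≤ s) (a) :
      |empMean A R s ω a - μ a| ≤ min ξ₁ ξ₂ := by
    have h1 := hT' (s := s) (by omega)
    have h2 := hA.sqrt_div_le_count (ω := ω) h1 a
    have hpos : 0 < count A s ω a := by linarith
    rw [empMean_sub hpos, abs_div, abs_of_pos hpos, div_le_iff₀ hpos]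
    exact (hdev s (by omega) a).trans
      (mul_le_mul_of_nonneg_right (min_le_left _ _) hpos.le)
  have hnear (s : ℕ) (hs : t₀ + T ≤ s) := hal (empMean A R s ω)
    (empMean_mem_Icc hR s) fun a => (hmean s hs a).trans (min_le_right _ _)
  have ht₀ : (0 : ℝ) ≤ t₀ := Nat.cast_nonneg _
  have hT0 : (0 : ℝ) ≤ T := Nat.cast_nonneg _
  have hone : (0 : ℝ) ≤ (T + 1) / ε' := by positivity
  have htwo : (0 : ℝ) < 1 / ε' ^ 2 := by positivity
  have hT1 : 1 ≤ T := by
    have : (0 : ℝ) < T := lt_of_lt_of_le (by positivity) hT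
    exact_mod_cast this
  have hT1' : (1 : ℝ) ≤ T := by exact_mod_cast hT1
  have hone' : 1 / ε' ≤ (T + 1) / ε' := div_le_div_of_nonneg_right (by linarith) hε'pos.le
  have ht1 : ((t₀ + T : ℕ) : ℝ) + 1 ≤ ε' * t := by
    have h1 : (t₀ + 1 : ℝ) * ((T + 1) / ε') ≤ t := by nlinarith
    have h2 : (t₀ + 1 : ℝ) * (T + 1) ≤ ε' * t := by
      have h3 := mul_le_mul_of_nonneg_left h1 hε'pos.le
      have e : ε' * ((t₀ + 1 : ℝ) * ((T + 1) / ε')) = (t₀ + 1 : ℝ) * (T + 1) := by field_simp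
      rwa [e] at h3
    push_cast
    nlinarith
  have ht2 : Real.sqrt t ≤ ε' * t := by
    have h1 : 1 / ε' ^ 2 ≤ t := by nlinarith
    have h2 : 1 / ε' ≤ Real.sqrt t := Real.le_sqrt_of_sq_le (by rwa [one_div_pow])
    rw [div_le_iff₀ hε'pos] at h2
    have h3 : Real.sqrt t * Real.sqrt t = t := Real.mul_self_sqrt (Nat.cast_nonneg t)
    nlinarith [Real.sqrt_nonneg t]
  have htT : t₀ + T ≤ t := by
    have : ((t₀ + T : ℕ) : ℝ) ≤ t := by push_cast; nlinarith
    exact_mod_cast this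
  have htpos : (0 : ℝ) < t := by exact_mod_cast (by omega : 0 < t)
  have hcount := hA.abs_count_sub_le hq.1 hε'pos.le hnear htT ht1 ht2
  refine ⟨g, ?_⟩
  have hlt := hev ((t : ℝ)⁻¹ • count A t ω) (empMean A R t ω)
    (fun a => mul_nonneg (by positivity) (count_nonneg t a)) (empMean_mem_Icc hR t) (fun a => ?_)
    fun a => (hmean t htT a).trans (min_le_left _ _)
  · rw [evidence_smul g (inv_pos.2 htpos), inv_mul_eq_div, lt_div_iff₀ htpos] at hlt
    exact hlt
  · have h1 := hcount a
    have e : ((t : ℝ)⁻¹ • count A t ω) a - q a = (count A t ω a - t * q a) / t := by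
      simp only [Pi.smul_apply, smul_eq_mul]
      field_simp
    rw [e, abs_div, abs_of_pos htpos, div_le_iff₀ htpos]
    have e2 : 3 * K * ε' = ξ₁ := by rw [hε']; field_simp
    rwa [e2] at h1

end Evidence

/-! ### Concentration of the empirical means -/

/-- The moment generating function bound for a centered Bernoulli variable. -/
lemma bernoulli_mgf_le {p r : ℝ} (hp : p ∈ Set.Icc (0 : ℝ) 1) (hr : |r| ≤ 1) :
    (1 - p) * Real.exp (-(r * p) - r ^ 2 / 2) + p * Real.exp (r * (1 - p) - r ^ 2 / 2) ≤ 1 := by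
  have hexp {x : ℝ} (hx : |x| ≤ 1) : Real.exp x ≤ 1 + x + x ^ 2 := by
    linarith [(abs_le.1 (Real.abs_exp_sub_one_sub_id_le hx)).2]
  have h0 : |-(r * p)| ≤ 1 := by
    rw [abs_neg, abs_mul, abs_of_nonneg hp.1]
    exact mul_le_one₀ hr hp.1 hp.2
  have h1 : |r * (1 - p)| ≤ 1 := by
    rw [abs_mul, abs_of_nonneg (by linarith [hp.2] : (0 : ℝ) ≤ 1 - p)]
    exact mul_le_one₀ hr (by linarith [hp.2]) (by linarith [hp.1])
  have h2 : (1 - p) * Real.exp (-(r * p)) + p * Real.exp (r * (1 - p)) ≤ Real.exp (r ^ 2 / 2) := by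
    have a := mul_le_mul_of_nonneg_left (hexp h0) (by linarith [hp.2] : (0 : ℝ) ≤ 1 - p)
    have b := mul_le_mul_of_nonneg_left (hexp h1) hp.1
    have c := Real.add_one_le_exp (r ^ 2 / 2)
    have d : (1 - p) * (1 + -(r * p) + (-(r * p)) ^ 2) +
        p * (1 + r * (1 - p) + (r * (1 - p)) ^ 2) = 1 + r ^ 2 * (p * (1 - p)) := by ring
    have e : p * (1 - p) ≤ 1 / 2 := by nlinarith [sq_nonneg (p - 1 / 2)]
    have f := mul_le_mul_of_nonneg_left e (sq_nonneg r)
    linarith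
  rw [Real.exp_sub, Real.exp_sub, ← mul_div_assoc, ← mul_div_assoc, ← add_div]
  exact div_le_one_of_le₀ h2 (Real.exp_pos _).le

section Concentration

variable {X G H Ω : Type*} {mΩ : MeasurableSpace Ω} {P : Measure Ω} [IsProbabilityMeasure P]
  {ℱ : Filtration ℕ mΩ} {μ : X × G × H → ℝ} {A : ℕ → Ω → X × G × H} {R : ℕ → Ω → ℝ}

lemma IsBandit.measurable_count (hAR : IsBandit P ℱ μ A R) (t : ℕ) (a : X × G × H) :
    Measurable[ℱ t] fun ω => count A t ω a := by
  classical
  induction t with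
  | zero => simp
  | succ t ih =>
    simp only [count_succ]
    exact (ih.mono (ℱ.mono t.le_succ) le_rfl).add (Measurable.ite
      (ℱ.mono t.le_succ _ (hAR.arm_predictable t a)) measurable_const measurable_const)

open scoped Classical in
lemma deviation_succ (t : ℕ) (ω : Ω) (a : X × G × H) : deviation A R μ (t + 1) ω a =
    deviation A R μ t ω a + if A t ω = a then R t ω - μ a else 0 :=
  Finset.sum_range_succ _ _

lemma IsBandit.measurable_deviation (hAR : IsBandit P ℱ μ A R) (t : ℕ) (a : X × G × H) :
    Measurable[ℱ t] fun ω => deviation A R μ t ω a := by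
  classical
  induction t with
  | zero => simp [deviation]
  | succ t ih =>
    simp only [deviation_succ]
    exact (ih.mono (ℱ.mono t.le_succ) le_rfl).add (Measurable.ite
      (ℱ.mono t.le_succ _ (hAR.arm_predictable t a))
      ((hAR.reward_adapted t).sub measurable_const) measurable_const)

lemma IsBandit.abs_deviation_le (hAR : IsBandit P ℱ μ A R) (hμ : ∀ a, μ a ∈ Set.Icc (0 : ℝ) 1)
    (t : ℕ) (ω : Ω) (a : X × G × H) : |deviation A R μ t ω a| ≤ t := by
  refine (Finset.abs_sum_le_sum_abs _ _).trans ((Finset.sum_le_card_nsmul _ _ 1 ?_).trans ?_)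
  · intro s _
    have := hμ a
    split_ifs
    · rw [abs_le]
      rcases hAR.reward_binary s ω with h | h <;> rw [h] <;>
        constructor <;> linarith [this.1, this.2]
    · simp
  · simp

/-- The exponential supermartingale of the rewards of arm `a`. -/
noncomputable def expProcess (A : ℕ → Ω → X × G × H) (R : ℕ → Ω → ℝ) (μ : X × G × H → ℝ) (r : ℝ)
    (a : X × G × H) (t : ℕ) (ω : Ω) : ℝ :=
  Real.exp (r * deviation A R μ t ω a - r ^ 2 / 2 * count A t ω a)

lemma IsBandit.measurable_expProcess (hAR : IsBandit P ℱ μ A R) (r : ℝ) (a : X × G × H) (t : ℕ) :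
    Measurable[ℱ t] (expProcess A R μ r a t) :=
  Real.measurable_exp.comp (((hAR.measurable_deviation t a).const_mul r).sub
    ((hAR.measurable_count t a).const_mul _))

lemma IsBandit.expProcess_le (hAR : IsBandit P ℱ μ A R) (hμ : ∀ a, μ a ∈ Set.Icc (0 : ℝ) 1)
    {r : ℝ} (hr : |r| ≤ 1) (a : X × G × H) (t : ℕ) (ω : Ω) :
    expProcess A R μ r a t ω ≤ Real.exp t := by
  refine Real.exp_le_exp.2 ?_
  have h1 : r * deviation A R μ t ω a ≤ 1 * t := (le_abs_self _).trans (by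
    rw [abs_mul]
    exact mul_le_mul hr (hAR.abs_deviation_le hμ t ω a) (abs_nonneg _) zero_le_one)
  have h2 : 0 ≤ r ^ 2 / 2 * count A t ω a := mul_nonneg (by positivity) (count_nonneg t a)
  linarith

lemma IsBandit.integrable_expProcess (hAR : IsBandit P ℱ μ A R)
    (hμ : ∀ a, μ a ∈ Set.Icc (0 : ℝ) 1) {r : ℝ} (hr : |r| ≤ 1) (a : X × G × H) (t : ℕ) :
    Integrable (expProcess A R μ r a t) P :=
  Integrable.of_bound
    ((hAR.measurable_expProcess r a t).mono (ℱ.le t) le_rfl).aestronglyMeasurable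
    (Real.exp t) (ae_of_all _ fun ω => by
      rw [Real.norm_eq_abs, expProcess, abs_of_pos (Real.exp_pos _)]
      exact hAR.expProcess_le hμ hr a t ω)

/-- Supermartingale step: a play of `a` multiplies the process by a factor whose conditional mean is
at most one by `bernoulli_mgf_le`. -/
lemma IsBandit.integral_expProcess_succ_le (hAR : IsBandit P ℱ μ A R)
    (hμ : ∀ a, μ a ∈ Set.Icc (0 : ℝ) 1) {r : ℝ} (hr : |r| ≤ 1) (a : X × G × H) (t : ℕ) :
    ∫ ω, expProcess A R μ r a (t + 1) ω ∂P ≤ ∫ ω, expProcess A R μ r a t ω ∂P := by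
  classical
  set Z := expProcess A R μ r a t
  set E : Set Ω := {ω | A t ω = a}
  set f : Ω → ℝ := E.indicator Z
  set k₀ := Real.exp (-(r * μ a) - r ^ 2 / 2)
  set k₁ := Real.exp (r * (1 - μ a) - r ^ 2 / 2)
  have hE := hAR.arm_predictable t a
  have hZint : Integrable Z P := hAR.integrable_expProcess hμ hr a t
  have hfint : Integrable f P := hZint.indicator (ℱ.le t _ hE)
  have hfm : StronglyMeasurable[ℱ t] f :=
    ((hAR.measurable_expProcess r a t).indicator hE).stronglyMeasurable
  have hRm : Measurable (R t) := (hAR.reward_adapted t).mono (ℱ.le _) le_rfl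
  have hRb (ω) : ‖R t ω‖ ≤ 1 := by rcases hAR.reward_binary t ω with h | h <;> simp [h]
  have hRint : Integrable (R t) P :=
    Integrable.of_bound hRm.aestronglyMeasurable 1 (ae_of_all _ hRb)
  have hfR : Integrable (f * R t) P :=
    hfint.mul_bdd hRm.aestronglyMeasurable (ae_of_all _ hRb)
  have hpull : ∫ ω, (f * R t) ω ∂P = μ a * ∫ ω, f ω ∂P := by
    rw [← integral_condExp (ℱ.le t), ← integral_const_mul]
    refine integral_congr_ae ?_
    filter_upwards [condExp_mul_of_stronglyMeasurable_left hfm hfR hRint, hAR.reward_mean t]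
      with ω h1 h2
    rw [h1, Pi.mul_apply, h2]
    by_cases hω : A t ω = a
    · rw [hω, mul_comm]
    · have : f ω = 0 := Set.indicator_of_notMem (s := E) hω _
      simp [this]
  -- A binary reward makes the factor `k₀ + (k₁ - k₀) R`, affine in `R`, so the conditional mean of
  -- the reward is all that is needed.
  have hstep (ω) : expProcess A R μ r a (t + 1) ω =
      Z ω + (k₀ - 1) * f ω + (k₁ - k₀) * (f * R t) ω := by
    rw [expProcess, deviation_succ, count_succ]
    by_cases hω : A t ω = a
    · have hf : f ω = Z ω := Set.indicator_of_mem (s := E) hω _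
      rw [Pi.mul_apply, hf, if_pos hω, if_pos hω]
      have e (u : ℝ) : Real.exp (r * (deviation A R μ t ω a + u) -
          r ^ 2 / 2 * (count A t ω a + 1)) = Z ω * Real.exp (r * u - r ^ 2 / 2) := by
        simp only [Z, expProcess, ← Real.exp_add]
        ring_nf
      rw [e]
      rcases hAR.reward_binary t ω with h | h
      · rw [h, zero_sub, mul_neg]; ring
      · rw [h]; ring
    · have hf : f ω = 0 := Set.indicator_of_notMem (s := E) hω _
      simp [hf, hω, Z, expProcess]
  simp only [hstep]
  rw [integral_add (f := fun ω => Z ω + (k₀ - 1) * f ω) (hZint.add (hfint.const_mul _))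
    (hfR.const_mul _), integral_add hZint (hfint.const_mul _), integral_const_mul, integral_const_mul, hpull]
  have hf0 : 0 ≤ ∫ ω, f ω ∂P := integral_nonneg fun ω =>
    Set.indicator_nonneg (fun _ _ => (Real.exp_pos _).le) ω
  have hk := bernoulli_mgf_le (hμ a) hr
  have : ((1 - μ a) * k₀ + μ a * k₁ - 1) * ∫ ω, f ω ∂P ≤ 0 :=
    mul_nonpos_of_nonpos_of_nonneg (by linarith) hf0
  linarith

lemma IsBandit.integral_expProcess_le_one (hAR : IsBandit P ℱ μ A R)
    (hμ : ∀ a, μ a ∈ Set.Icc (0 : ℝ) 1) {r : ℝ} (hr : |r| ≤ 1) (a : X × G × H) (t : ℕ) :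
    ∫ ω, expProcess A R μ r a t ω ∂P ≤ 1 := by
  induction t with
  | zero => simp [expProcess, deviation]
  | succ t ih => exact (hAR.integral_expProcess_succ_le hμ hr a t).trans ih

/-- Markov's inequality for `r = ±ξ`. On the event the exponent of one of the two processes is at
least `ξ² N - ξ² N / 2`, and the deterministic bound `n ≤ N` removes the random count. -/
lemma IsBandit.measureReal_deviation_gt_le (hAR : IsBandit P ℱ μ A R)
    (hμ : ∀ a, μ a ∈ Set.Icc (0 : ℝ) 1) {ξ : ℝ} (hξ : 0 < ξ) (hξ1 : ξ ≤ 1) (a : X × G × H)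
    (t : ℕ) {n : ℝ} (hn : ∀ ω, n ≤ count A t ω a) :
    P.real {ω | ξ * count A t ω a < |deviation A R μ t ω a|} ≤
      2 * Real.exp (-(ξ ^ 2 / 2 * n)) := by
  have hξ' : |ξ| ≤ 1 := by rwa [abs_of_pos hξ]
  have markov {r : ℝ} (hr : |r| ≤ 1) :
      P.real {ω | Real.exp (ξ ^ 2 / 2 * n) ≤ expProcess A R μ r a t ω} ≤
        Real.exp (-(ξ ^ 2 / 2 * n)) := by
    have h := mul_meas_ge_le_integral_of_nonneg (ae_of_all P fun ω => (Real.exp_pos _).le)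
      (hAR.integrable_expProcess hμ hr a t) (Real.exp (ξ ^ 2 / 2 * n))
    have h2 := h.trans (hAR.integral_expProcess_le_one hμ hr a t)
    rw [Real.exp_neg, ← one_div, le_div_iff₀ (Real.exp_pos _), mul_comm]
    exact h2
  refine (measureReal_mono (s₂ := {ω | Real.exp (ξ ^ 2 / 2 * n) ≤ expProcess A R μ ξ a t ω} ∪
    {ω | Real.exp (ξ ^ 2 / 2 * n) ≤ expProcess A R μ (-ξ) a t ω}) ?_).trans
    ((measureReal_union_le _ _).trans ?_)
  · intro ω hω
    have hω' : ξ * count A t ω a < |deviation A R μ t ω a| := hω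
    have hc : ξ ^ 2 / 2 * n ≤ ξ ^ 2 / 2 * count A t ω a :=
      mul_le_mul_of_nonneg_left (hn ω) (by positivity)
    rcases lt_abs.1 hω' with h | h
    · left
      refine Real.exp_le_exp.2 ?_
      have := mul_lt_mul_of_pos_left h hξ
      linarith
    · right
      refine Real.exp_le_exp.2 ?_
      have := mul_lt_mul_of_pos_left h hξ
      linarith
  · linarith [markov hξ', markov (r := -ξ) (by rwa [abs_neg])]

variable [Fintype X] [Fintype G] [Fintype H] [Nonempty G] {σ : ℝ}

/-- Under forced exploration, the probability of a large deviation decreases as `t⁻³`. -/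
lemma IsBandit.exists_measureReal_le (hAR : IsBandit P ℱ μ A R) (hA : IsTracking σ A R)
    (hμ : ∀ a, μ a ∈ Set.Icc (0 : ℝ) 1) {ξ : ℝ} (hξ : 0 < ξ) (hξ1 : ξ ≤ 1) :
    ∃ C ≥ 0, ∀ t : ℕ, P.real {ω | ∃ a, ξ * count A t ω a < |deviation A R μ t ω a|} ≤
      C / (t + 1 : ℝ) ^ 3 := by
  set K : ℝ := ((Fintype.card (X × G × H) : ℕ) : ℝ)
  set s : ℝ := ξ ^ 2 / 8
  have hs : 0 < s := by positivity
  have hK : 0 ≤ K := Nat.cast_nonneg _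
  -- The first term is the union bound over arms and two signs. The second makes the estimate
  -- trivial while `√t ≤ 2K + 4`.
  set C₀ : ℝ := 2 * K + Real.exp (s * (2 * K + 4))
  have hC₀ : 0 ≤ C₀ := by positivity
  have h1 (t : ℕ) : P.real {ω | ∃ a, ξ * count A t ω a < |deviation A R μ t ω a|} ≤
      C₀ * Real.exp (-(s * Real.sqrt t)) := by
    rcases le_total (2 * K + 4) (Real.sqrt t) with ht | ht
    · have hsub : {ω | ∃ a, ξ * count A t ω a < |deviation A R μ t ω a|} =
          ⋃ a, {ω | ξ * count A t ω a < |deviation A R μ t ω a|} := by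
        ext ω; simp
      rw [hsub]
      refine (measureReal_iUnion_fintype_le _).trans ((Finset.sum_le_sum fun a _ =>
        hAR.measureReal_deviation_gt_le hμ hξ hξ1 a t
          fun ω => hA.sqrt_div_le_count ht a).trans ?_)
      rw [Finset.sum_const, Finset.card_univ, nsmul_eq_mul]
      have e : ξ ^ 2 / 2 * (Real.sqrt t / 4) = s * Real.sqrt t := by simp only [s]; ring
      rw [e]
      have : 0 ≤ Real.exp (s * (2 * K + 4)) * Real.exp (-(s * Real.sqrt t)) := by positivity
      simp only [C₀]
      linarith
    · refine measureReal_le_one.trans ?_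
      have h2 : 1 ≤ Real.exp (s * (2 * K + 4)) * Real.exp (-(s * Real.sqrt t)) := by
        rw [← Real.exp_add]
        refine Real.one_le_exp ?_
        nlinarith
      have : 0 ≤ 2 * K * Real.exp (-(s * Real.sqrt t)) := by positivity
      simp only [C₀]
      linarith
  -- The sixth-order term of the exponential series (`720 = 6!`) turns `√(t+1)` into `(t+1)³`; the
  -- factor `exp s` pays for replacing `√t` by `√(t+1)`.
  refine ⟨C₀ * (Real.exp s * (720 / s ^ 6)), by positivity, fun t => (h1 t).trans ?_⟩
  rw [mul_div_assoc]
  refine mul_le_mul_of_nonneg_left ?_ hC₀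
  have hsq : Real.sqrt (t + 1) ≤ Real.sqrt t + 1 := by
    refine Real.sqrt_le_iff.2 ⟨by positivity, ?_⟩
    have := Real.sq_sqrt (Nat.cast_nonneg (α := ℝ) t)
    nlinarith [Real.sqrt_nonneg t]
  have h2 : Real.exp (-(s * Real.sqrt t)) ≤ Real.exp s * Real.exp (-(s * Real.sqrt (t + 1))) := by
    rw [← Real.exp_add]
    refine Real.exp_le_exp.2 ?_
    nlinarith
  have h3 : Real.exp (-(s * Real.sqrt (t + 1))) ≤ 720 / s ^ 6 / (t + 1 : ℝ) ^ 3 := by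
    have h4 := Real.pow_div_factorial_le_exp (s * Real.sqrt (t + 1)) (by positivity) 6
    have h5 : Real.sqrt (t + 1) ^ 6 = (t + 1 : ℝ) ^ 3 := by
      rw [show 6 = 2 * 3 by norm_num, pow_mul, Real.sq_sqrt (by positivity)]
    rw [mul_pow, h5, show (Nat.factorial 6 : ℝ) = 720 by norm_num [Nat.factorial]] at h4
    rw [Real.exp_neg, inv_le_comm₀ (Real.exp_pos _) (by positivity)]
    refine le_trans (le_of_eq ?_) h4
    field_simp
  refine h2.trans ?_
  rw [mul_div_assoc]
  exact mul_le_mul_of_nonneg_left h3 (Real.exp_pos _).le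

/-- After a time with finite mean, all empirical means stay close to the true means. -/
lemma IsBandit.exists_settling_time (hAR : IsBandit P ℱ μ A R) (hA : IsTracking σ A R)
    (hμ : ∀ a, μ a ∈ Set.Icc (0 : ℝ) 1) {ξ : ℝ} (hξ : 0 < ξ) (hξ1 : ξ ≤ 1) :
    ∃ B : Ω → ℝ≥0∞, Measurable B ∧ ∫⁻ ω, B ω ∂P ≠ ∞ ∧ ∀ ω (t : ℕ), B ω < t + 1 →
      ∀ a, |deviation A R μ t ω a| ≤ ξ * count A t ω a := by
  obtain ⟨C, hC, hbound⟩ := hAR.exists_measureReal_le hA hμ hξ hξ1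
  set bad : ℕ → Set Ω := fun t => {ω | ∃ a, ξ * count A t ω a < |deviation A R μ t ω a|}
  have hbad (t) : MeasurableSet (bad t) := by
    have : bad t = ⋃ a, {ω | ξ * count A t ω a < |deviation A R μ t ω a|} := by
      ext ω; simp [bad]
    rw [this]
    refine MeasurableSet.iUnion fun a => measurableSet_lt ?_ ?_
    · exact ((hAR.measurable_count t a).mono (ℱ.le t) le_rfl).const_mul ξ
    · exact ((hAR.measurable_deviation t a).mono (ℱ.le t) le_rfl).abs
  have hterm (t : ℕ) : Measurable ((bad t).indicator fun _ => (t + 1 : ℝ≥0∞)) :=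
    measurable_const.indicator (hbad t)
  -- `B` is the sum of `t + 1` over the bad times `t`. It dominates each of them, is plainly
  -- measurable, and has mean `∑ (t+1) P(bad t)`, summable thanks to the cubic decay.
  refine ⟨fun ω => ∑' t : ℕ, (bad t).indicator (fun _ => (t + 1 : ℝ≥0∞)) ω,
    Measurable.tsum hterm, ?_, ?_⟩
  · rw [lintegral_tsum fun t => (hterm t).aemeasurable]
    simp only [lintegral_indicator_const (hbad _)]
    have hsum : Summable fun t : ℕ => C / (t + 1 : ℝ) ^ 2 := by
      have := (summable_nat_add_iff 1).2 (Real.summable_one_div_nat_pow.2 one_lt_two)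
      refine (this.mul_left C).congr fun t => ?_
      push_cast
      ring
    refine ne_top_of_le_ne_top hsum.tsum_ofReal_ne_top (ENNReal.tsum_le_tsum fun t => ?_)
    have h1 : P (bad t) ≤ ENNReal.ofReal (C / (t + 1 : ℝ) ^ 3) := by
      rw [← ofReal_measureReal]
      exact ENNReal.ofReal_le_ofReal (hbound t)
    have h2 : (t + 1 : ℝ≥0∞) = ENNReal.ofReal (t + 1 : ℝ) := by
      rw [ENNReal.ofReal_add (by positivity) zero_le_one]; simp
    refine (mul_le_mul_right h1 _).trans (le_of_eq ?_)
    rw [h2, ← ENNReal.ofReal_mul (by positivity)]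
    congr 1
    field_simp
  · intro ω t ht a
    by_contra! hlt
    have hmem : ω ∈ bad t := ⟨a, hlt⟩
    have := ENNReal.le_tsum (f := fun t : ℕ => (bad t).indicator (fun _ => (t + 1 : ℝ≥0∞)) ω) t
    simp only [Set.indicator_of_mem hmem] at this
    exact this.not_gt ht

end Concentration

/-! ### Expected stopping time and the limit in the confidence level -/

lemma tauG_le {X G H Ω : Type*} [Fintype X] [Fintype G] [Fintype H] {A : ℕ → Ω → X × G × H}
    {R : ℕ → Ω → ℝ} {β : ℕ → ℝ} {ω : Ω} {t : ℕ} (ht : 1 ≤ t) {g : G}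
    (hg : β t < Psi A R t ω g) : tauG A R β ω ≤ t :=
  iInf₂_le t ⟨ht, hg.trans_le (le_ciSup (f := fun g => Psi A R t ω g)
    (Set.finite_range _).bddAbove g)⟩

/-- The sum is `(1 - 2δ) log(1 - δ) + 2 δ log δ`, which is continuous at `0`. -/
lemma tendsto_kl_add_log :
    Tendsto (fun δ : ℝ => kl δ (1 - δ) + Real.log δ) (𝓝[>] (0 : ℝ)) (𝓝 0) := by
  have hc : ContinuousAt (fun δ : ℝ => (1 - 2 * δ) * Real.log (1 - δ) + 2 * (δ * Real.log δ)) 0 := by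
    have h1 : ContinuousAt (fun δ : ℝ => Real.log (1 - δ)) 0 :=
      (by fun_prop : ContinuousAt (fun δ : ℝ => 1 - δ) 0).log (by norm_num)
    have h2 : ContinuousAt (fun δ : ℝ => δ * Real.log δ) 0 := Real.continuous_mul_log.continuousAt
    exact ((by fun_prop : ContinuousAt (fun δ : ℝ => 1 - 2 * δ) 0).mul h1).add
      (h2.const_mul 2)
  have ht : Tendsto (fun δ : ℝ => (1 - 2 * δ) * Real.log (1 - δ) + 2 * (δ * Real.log δ))
      (𝓝[>] (0 : ℝ)) (𝓝 0) := by
    have := hc.tendsto.mono_left (nhdsWithin_le_nhds (s := Set.Ioi (0 : ℝ)))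
    simpa using this
  refine ht.congr' ?_
  filter_upwards [Ioo_mem_nhdsGT (zero_lt_one' ℝ)] with δ hδ
  have h1 : 1 - δ ≠ 0 := by linarith [hδ.2]
  rw [kl, sub_sub_cancel, Real.log_div hδ.1.ne' h1, Real.log_div h1 hδ.1.ne']
  ring

lemma eventually_le_mul_kl {a b C : ℝ} (ha : 0 < a) (hab : a < b) :
    ∀ᶠ δ in 𝓝[>] (0 : ℝ), a * -Real.log δ + C ≤ b * kl δ (1 - δ) := by
  have h1 := tendsto_kl_add_log.eventually (lt_mem_nhds (show (-1 : ℝ) < 0 by norm_num))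
  have h2 := (tendsto_neg_atBot_atTop.comp Real.tendsto_log_nhdsGT_zero).eventually_ge_atTop
    ((C + b) / (b - a))
  filter_upwards [h1, h2] with δ h1 h2
  simp only [Function.comp_apply] at h2
  rw [div_le_iff₀ (by linarith)] at h2
  nlinarith

section Main

variable {X G H Ω : Type*} [Fintype X] [Fintype G] [Fintype H] [Nonempty X] [Nontrivial G]
  [Nonempty H] {mΩ : MeasurableSpace Ω} {P : Measure Ω} [IsProbabilityMeasure P]
  {ℱ : Filtration ℕ mΩ} {μ q : X × G × H → ℝ} {A : ℕ → Ω → X × G × H} {R : ℕ → Ω → ℝ}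
  {σ : ℝ} {β : ℕ → ℝ → ℝ} {C D : ℝ}

/-- For each `ω` one explicit time satisfies the stopping condition, so `τ` lies below a constant
plus a multiple of `B`. Only this measurable bound is integrated explicitly. `M` does not depend on
`δ`. -/
lemma exists_lintegral_tauG_le (hμ : μ ∈ models X G H) (hAR : IsBandit P ℱ μ A R) (hσ : 0 < σ)
    (hA : IsTracking σ A R) (hC : 0 < C) (hD : 0 < D)
    (hβ : ∀ t : ℕ, C ≤ (t : ℝ) → ∀ δ ∈ Set.Ioo (0 : ℝ) 1, β t δ ≤ Real.log (D * t / δ))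
    (hq : IsOptAlloc σ μ q) {ε : ℝ} (hε : 0 < ε) (hερ : 2 * ε < rho q μ) :
    ∃ M : ℝ, ∀ δ ∈ Set.Ioo (0 : ℝ) 1,
      ∫⁻ ω, (tauG A R (fun t => β t δ) ω : ℝ≥0∞) ∂P ≤
        ENNReal.ofReal (1 / (rho q μ - 2 * ε) * -Real.log δ + M) := by
  obtain ⟨ξ, hξ, hξ1, c, hc, hΨ⟩ :=
    hA.exists_forall_lt_Psi hσ hμ hAR.reward_binary hq hε
  obtain ⟨B, hBm, hBint, hB⟩ := hAR.exists_settling_time hA hμ.1 hξ hξ1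
  set r := rho q μ - 2 * ε with hr
  have hrpos : 0 < r := by linarith
  set C₀ := |Real.log D - Real.log ε|
  -- The constants left after `t < u + 1` and `t₀ < B + 1`: the rounding of `t₀` and its shift cost
  -- `2c`.
  set M₀ := C₀ / r + C + 2 * c + 2
  have hM₀ : 0 ≤ M₀ := by positivity
  refine ⟨M₀ + c * (∫⁻ ω, B ω ∂P).toReal, fun δ hδ => ?_⟩
  have hL : 0 ≤ -Real.log δ := by linarith [Real.log_neg hδ.1 hδ.2]
  have hr' : 0 ≤ 1 / r * -Real.log δ := mul_nonneg (by positivity) hL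
  have hpt (ω) : (tauG A R (fun t => β t δ) ω : ℝ≥0∞) ≤
      ENNReal.ofReal (1 / r * -Real.log δ + M₀) + ENNReal.ofReal c * B ω := by
    by_cases hBω : B ω = ∞
    · rw [hBω, ENNReal.mul_top (by simpa using hc)]
      simp
    set t₀ := ⌈(B ω).toReal⌉₊
    have ht₀ : ∀ t : ℕ, t₀ ≤ t → B ω < t + 1 := fun t ht => by
      rw [← ENNReal.ofReal_toReal hBω]
      have h1 : (B ω).toReal < (t + 1 : ℕ) :=
        (Nat.le_ceil _).trans_lt (by exact_mod_cast Nat.lt_succ_of_le ht)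
      have h2 := (ENNReal.ofReal_lt_ofReal_iff (by positivity)).2 h1
      rw [ENNReal.ofReal_natCast] at h2
      exact_mod_cast h2
    have ht₀' : (t₀ : ℝ) < (B ω).toReal + 1 := Nat.ceil_lt_add_one ENNReal.toReal_nonneg
    -- Each term meets one demand: crossing the threshold (first two), validity of the bound on `β`,
    -- linear growth of `Ψ`, and `t ≥ 1`.
    set u : ℝ := 1 / r * -Real.log δ + C₀ / r + C + c * (t₀ + 1 : ℝ) + 1
    have hcr : 0 ≤ C₀ / r := by positivity
    have hct : 0 ≤ c * (t₀ + 1 : ℝ) := by positivity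
    have hu : 0 ≤ u := by simp only [u]; positivity
    set t := ⌈u⌉₊
    have htu : u ≤ t := Nat.le_ceil u
    have htu' : (t : ℝ) < u + 1 := Nat.ceil_lt_add_one hu
    have ht1 : (1 : ℝ) ≤ t := by simp only [u] at htu; linarith
    obtain ⟨g, hg⟩ := hΨ ω t₀ (fun s hs => hB ω s (ht₀ s hs)) t (by
      simp only [u] at htu; linarith)
    have hβt : β t δ ≤ (rho q μ - ε) * t := by
      refine (hβ t (by simp only [u] at htu; linarith) δ hδ).trans ?_
      rw [Real.log_div (by positivity) hδ.1.ne', Real.log_mul hD.ne' (by positivity)]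
      -- The `log t` in the threshold is absorbed by a second loss of `ε` in the slope, whence `ρ -
      -- 2ε`.
      have h1 : Real.log t ≤ ε * t - Real.log ε := by
        have h2 := Real.log_le_sub_one_of_pos (show 0 < ε * t by positivity)
        rw [Real.log_mul hε.ne' (by positivity)] at h2
        linarith
      have h3 : (-Real.log δ + C₀) / r ≤ t := by
        have : (-Real.log δ + C₀) / r = 1 / r * -Real.log δ + C₀ / r := by ring
        rw [this]
        simp only [u] at htu; linarith
      rw [div_le_iff₀ hrpos] at h3
      have h4 := le_abs_self (Real.log D - Real.log ε)
      have h5 : (t : ℝ) * r = (rho q μ - ε) * t - ε * t := by rw [hr]; ring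
      linarith
    have hτ : tauG A R (fun t => β t δ) ω ≤ t :=
      tauG_le (by exact_mod_cast ht1) (hβt.trans_lt hg)
    have hτ' : (tauG A R (fun t => β t δ) ω : ℝ≥0∞) ≤ (t : ℝ≥0∞) := by
      simpa using ENat.toENNReal_le.2 hτ
    refine hτ'.trans ?_
    rw [← ENNReal.ofReal_toReal hBω, ← ENNReal.ofReal_mul hc.le,
      ← ENNReal.ofReal_add (by positivity) (by positivity), ← ENNReal.ofReal_natCast]
    refine ENNReal.ofReal_le_ofReal ?_
    have := mul_lt_mul_of_pos_left ht₀' hc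
    simp only [u, M₀] at htu' ⊢
    linarith
  refine (lintegral_mono hpt).trans ?_
  rw [lintegral_add_left measurable_const, lintegral_const, measure_univ, mul_one,
    lintegral_const_mul _ hBm]
  nth_rewrite 1 [← ENNReal.ofReal_toReal hBint]
  rw [← ENNReal.ofReal_mul hc.le, ← ENNReal.ofReal_add (by positivity) (by positivity), add_assoc]

lemma eventually_lintegral_tauG_div_le (hμ : μ ∈ models X G H) (hAR : IsBandit P ℱ μ A R)
    (hσ : 0 < σ) (hA : IsTracking σ A R) (hC : 0 < C) (hD : 0 < D)
    (hβ : ∀ t : ℕ, C ≤ (t : ℝ) → ∀ δ ∈ Set.Ioo (0 : ℝ) 1, β t δ ≤ Real.log (D * t / δ))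
    (hq : IsOptAlloc σ μ q) {κ : ℝ} (hκ : 1 < κ) :
    ∀ᶠ δ in 𝓝[>] (0 : ℝ), (∫⁻ ω, (tauG A R (fun t => β t δ) ω : ℝ≥0∞) ∂P) /
      ENNReal.ofReal (kl δ (1 - δ) / rho q μ) ≤ ENNReal.ofReal κ := by
  have hρ := rho_pos hσ hμ hq
  set ρ := rho q μ
  -- With this choice `ρ - 2ε = ρ (κ + 1) / (2κ)`, so `1 / (ρ - 2ε) < κ / ρ`, leaving room to absorb
  -- the constant `M` as `δ → 0`.
  set ε := ρ * (κ - 1) / (4 * κ) with hε'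
  have hε : 0 < ε := div_pos (mul_pos hρ (by linarith)) (by linarith)
  have e1 : κ * (ρ - 2 * ε) = ρ * (κ + 1) / 2 := by
    rw [hε']; field_simp; ring
  have hερ : 0 < ρ - 2 * ε := by
    refine pos_of_mul_pos_right (a := κ) ?_ (by linarith)
    rw [e1]; positivity
  have hlt : 1 / (ρ - 2 * ε) < κ / ρ := by
    rw [div_lt_div_iff₀ hερ hρ, e1]
    nlinarith
  obtain ⟨M, hM⟩ := exists_lintegral_tauG_le hμ hAR hσ hA hC hD hβ hq hε (by linarith)
  filter_upwards [Ioo_mem_nhdsGT (zero_lt_one' ℝ),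
    eventually_le_mul_kl (C := M) (one_div_pos.2 hερ) hlt] with δ hδ hkl
  refine ENNReal.div_le_of_le_mul ((hM δ hδ).trans ?_)
  rw [← ENNReal.ofReal_mul (by linarith)]
  refine ENNReal.ofReal_le_ofReal (hkl.trans (le_of_eq ?_))
  ring

/-- The penalty is nonnegative, so `max ρ_σ ≤ ρ(q, μ)`. A nonpositive maximum is covered too, since
`ENNReal.ofReal` truncates it to `0`. -/
lemma div_rho_le_KReg (hσ : 0 < σ) (hμ : μ ∈ models X G H) (hq : IsOptAlloc σ μ q) (δ : ℝ) :
    ENNReal.ofReal (kl δ (1 - δ) / rho q μ) ≤ KReg σ μ δ := by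
  rw [KReg, ENNReal.ofReal_div_of_pos (rho_pos hσ hμ hq)]
  refine ENNReal.div_le_div_left (ENNReal.ofReal_le_ofReal ?_) _
  have : Nonempty (stdSimplex ℝ (X × G × H)) := ⟨⟨q, hq.1⟩⟩
  refine ciSup_le fun q' => (hq.2 q' q'.2).trans ?_
  rw [rhoReg, sub_le_self_iff]
  exact div_nonneg (Finset.sum_nonneg fun _ _ => sq_nonneg _) (by positivity)

end Main

lemma limsup_le_one_of_eventually_le {α : Type*} {f : Filter α} {u : α → ℝ≥0∞}
    (h : ∀ κ : ℝ, 1 < κ → ∀ᶠ x in f, u x ≤ ENNReal.ofReal κ) : limsup u f ≤ 1 := by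
  refine ENNReal.le_of_forall_pos_le_add fun ε hε _ => limsup_le_of_le (by isBoundedDefault) ?_
  filter_upwards [h (1 + ε) (by simpa using hε)] with x hx
  rwa [ENNReal.ofReal_add zero_le_one ε.coe_nonneg, ENNReal.ofReal_one, ENNReal.ofReal_coe_nnreal] at hx

end OSRL

theorem mainTheorem1 {X G H Ω : Type*}
    [Fintype X] [Fintype G] [Fintype H] [Nonempty X] [Nontrivial G] [Nonempty H]
    {mΩ : MeasurableSpace Ω} (P : Measure Ω) [IsProbabilityMeasure P] (ℱ : Filtration ℕ mΩ)
    (μ : X × G × H → ℝ) (hμ : μ ∈ OSRL.models X G H)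
    (A : ℕ → Ω → X × G × H) (R : ℕ → Ω → ℝ) (hAR : OSRL.IsBandit P ℱ μ A R)
    (σ : ℝ) (hσ : 0 < σ) (hA : OSRL.IsTracking σ A R)
    (β : ℕ → ℝ → ℝ)
    (hβ_mono : ∀ δ ∈ Set.Ioo (0 : ℝ) 1, MonotoneOn (fun t => β t δ) (Set.Ici 1))
    (C D : ℝ) (hC : 0 < C) (hD : 0 < D)
    (hβ : ∀ t : ℕ, C ≤ (t : ℝ) → ∀ δ ∈ Set.Ioo (0 : ℝ) 1, β t δ ≤ Real.log (D * t / δ)) :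
    limsup (fun δ : ℝ =>
        (∫⁻ ω, (OSRL.tauG A R (fun t => β t δ) ω : ℝ≥0∞) ∂P) / OSRL.KReg σ μ δ)
      (𝓝[>] (0 : ℝ)) ≤ 1 ∧
    ∀ q : X × G × H → ℝ, OSRL.IsOptAlloc σ μ q →
      limsup (fun δ : ℝ =>
          (∫⁻ ω, (OSRL.tauG A R (fun t => β t δ) ω : ℝ≥0∞) ∂P) /
            ENNReal.ofReal (OSRL.kl δ (1 - δ) / OSRL.rho q μ))
        (𝓝[>] (0 : ℝ)) ≤ 1 := by

  obtain ⟨q₀, hq₀⟩ := OSRL.exists_isOptAlloc σ hμ.1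
  refine ⟨OSRL.limsup_le_one_of_eventually_le fun κ hκ => ?_,
    fun q hq => OSRL.limsup_le_one_of_eventually_le fun κ hκ => ?_⟩
  · filter_upwards [OSRL.eventually_lintegral_tauG_div_le hμ hAR hσ hA hC hD hβ hq₀ hκ]
      with δ hδ
    exact (ENNReal.div_le_div_left (OSRL.div_rho_le_KReg hσ hμ hq₀ δ) _).trans hδ
  · exact OSRL.eventually_lintegral_tauG_div_le hμ hAR hσ hA hC hD hβ hq hκ
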